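/- Let $(M,g)$ be a smooth four-dimensional manifold with a metric of neutral signature $(2,2)$ and Levi-Civita connection $\nabla$, and let $Z_{[\pi]}$, $W_{[\lambda]}$ be a distribution of $\alpha$-planes and a distribution of $\beta$-planes on $M$. That is, locally $T_xM\cong S_x\otimes S'_x$ with $g_{ab}=\varepsilon_{AB}\varepsilon_{A'B'}$, where $S,S'$ are the real two-dimensional bundles of unprimed and primed spinors, and $Z_{[\pi]}=\{\mu^A\pi^{A'}:\mu\in S\}$, $W_{[\lambda]}=\{\lambda^A\nu^{A'}:\nu\in S'\}$ for smooth nowhere vanishing spinor fields $\pi^{A'}$, $\lambda^A$. Such $\pi^{A'}$ and $\lambda^A$ are called local scaled representatives (LSRs) of $[\pi^{A'}]$ and $[\lambda^A]$. Put $\mathcal D=Z_{[\pi]}\cap W_{[\lambda]}=\langle\lambda^A\pi^{A'}\rangle$ and $\mathcal H=\mathcal D^\perp$. A distribution is integrable (in the sense of Frobenius) if its sections are closed under the Lie bracket, parallel if $\nabla_XY$ is a section of it for every section $Y$ of it and every vector field $X$, and auto-parallel if $\nabla_XY$ is a section of it for all sections $X,Y$ of it; sections are smooth and local. For an LSR $\lambda^A$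 put $\tilde S_b=\lambda_A\nabla_b\lambda^A$. Suppose that $(M,g,[\pi^{A'}])$ is a Walker geometry, i.e. that $Z_{[\pi]}$ is parallel. (1) $W_{[\lambda]}$ and $\mathcal H$ are both integrable if and only if $\tilde S_b\propto\lambda_B\pi_{B'}$ for LSRs $\pi^{A'}$, $\lambda^A$, i.e. $\tilde S_b=f\lambda_B\pi_{B'}$ with a function $f$, which may have zeros. (This holds over the domain of any given pair of LSRs, and over $M$ with the condition imposed on a family of pairs of LSRs whose domains cover $M$.) Suppose from now on that $W_{[\lambda]}$ is integrable (a sesquiWalker $\alpha\beta$-geometry). (2) For each pair of LSRs there is a smooth spinor field $\kappa_{B'}$ with $\tilde S_b=\lambda_B\kappa_{B'}$, and $\mathcal H$ is integrable if and only if $\pi^{B'}\kappa_{B'}=0$, i.e. $\kappa^{A'}$ is a smooth multiple $f\pi^{A'}$ of $\pi^{A'}$ (where $\kappa^{A'}$ has no zeros: if and only if $\kappa^{A'}$ is an LSR of $[\pi^{A'}]$). As in (1), this holds over the domain of any pair of LSRs and over the union of any family of such domains. (3) If $\mathcal H$ is integrable, then over the domain of any pair of LSRs $\pi^{A'}$,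 $\lambda^A$ on which $\tilde S_b$ has no zeros: keeping $\lambda^A$, there is an LSR $\hat\pi^{A'}$ of $[\pi^{A'}]$ with $\lambda_A\nabla_b\lambda^A=\lambda_B\hat\pi_{B'}$; and keeping $\pi^{A'}$, there is an LSR $\hat\lambda^A$ of $[\lambda^A]$ with $\hat\lambda_A\nabla_b\hat\lambda^A=\hat\lambda_B\pi_{B'}$. (4) $\mathcal H$ is integrable if and only if it is auto-parallel, on $M$ and on each open subset of $M$. -/

import Mathlib

open scoped Manifold ContDiff

noncomputable section

namespace AlphaBeta

/-- The model space of four-dimensional manifolds. -/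
abbrev E4 : Type := EuclideanSpace ℝ (Fin 4)

variable {M : Type*} [TopologicalSpace M] [ChartedSpace E4 M]

/-- A (not necessarily continuous) vector field on `M`. It is used as a local vector field on an
open set `U` by imposing `SmoothVF X U`; its values off `U` are irrelevant. -/
abbrev VF (M : Type*) [TopologicalSpace M] [ChartedSpace E4 M] : Type _ :=
  (x : M) → TangentSpace (𝓡 4) x

/-- The function `f` (with values in a normed space) is smooth on `U`. -/
def SmoothFn {F : Type*} [NormedAddCommGroup F] [NormedSpace ℝ F] (f : M → F) (U : Set M) : Prop :=
  ContMDiffOn (𝓡 4) 𝓘(ℝ, F) ∞ f U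

/-- The derivative `X f` of a scalar function along a vector field, at `x`. -/
def dirDeriv (X : VF M) (f : M → ℝ) (x : M) : ℝ :=
  mfderiv (𝓡 4) 𝓘(ℝ, ℝ) f x (X x)

/-- The vector field `X` is smooth on `U`. -/
def SmoothVF [IsManifold (𝓡 4) ∞ M] (X : VF M) (U : Set M) : Prop :=
  ContMDiffOn (𝓡 4) (𝓡 4).tangent ∞ (fun x => (⟨x, X x⟩ : TangentBundle (𝓡 4) M)) U

/-- A smooth metric of neutral signature `(+,+,-,-)` on a four-manifold. -/
structure NeutralMetric (M : Type*) [TopologicalSpace M] [ChartedSpace E4 M]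
    [IsManifold (𝓡 4) ∞ M] where
  /-- The scalar product on each tangent space. -/
  inner (x : M) : TangentSpace (𝓡 4) x →L[ℝ] TangentSpace (𝓡 4) x →L[ℝ] ℝ
  symm (x : M) (v w : TangentSpace (𝓡 4) x) : inner x v w = inner x w v
  /-- Every tangent space has an orthonormal basis with squared norms `1, 1, -1, -1`. -/
  neutral (x : M) : ∃ b : Module.Basis (Fin 4) ℝ (TangentSpace (𝓡 4) x),
    ∀ i j, inner x (b i) (b j) = if i = j then (if i < 2 then 1 else -1) else 0
  contMDiff : ContMDiff (𝓡 4) ((𝓡 4).prod 𝓘(ℝ, E4 →L[ℝ] E4 →L[ℝ] ℝ)) ∞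
    (fun x => Bundle.TotalSpace.mk' (E4 →L[ℝ] E4 →L[ℝ] ℝ) x (inner x))

section Connection

variable [IsManifold (𝓡 4) ∞ M] (g : NeutralMetric M)

/-- The metric at a point as a bilinear form. -/
def NeutralMetric.bilin (x : M) : LinearMap.BilinForm ℝ (TangentSpace (𝓡 4) x) :=
  LinearMap.mk₂ ℝ (fun v w => g.inner x v w) (by simp) (by simp) (by simp) (by simp)

theorem NeutralMetric.eq_zero_of_inner {x : M} {v : TangentSpace (𝓡 4) x}
    (h : ∀ w, g.inner x v w = 0) : v = 0 := by
  obtain ⟨b, hb⟩ := g.neutral x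
  rw [← b.sum_repr v]
  refine Finset.sum_eq_zero fun j _ => ?_
  have h1 := h (b j)
  rw [← b.sum_repr v] at h1
  simp only [map_sum, map_smul, sum_apply, smul_apply,
    hb, smul_eq_mul] at h1
  have h2 : b.repr v j = 0 := by
    simp only [mul_ite, mul_zero, Finset.sum_ite_eq', Finset.mem_univ, if_true] at h1
    split_ifs at h1 <;> linarith
  rw [h2, zero_smul]

theorem NeutralMetric.nondegenerate (x : M) : (g.bilin x).Nondegenerate := by
  constructor
  · intro v h
    exact g.eq_zero_of_inner h
  · intro v h
    refine g.eq_zero_of_inner fun w => ?_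
    rw [g.symm]
    exact h w

instance finiteDimensional_tangentSpace (x : M) :
    FiniteDimensional ℝ (TangentSpace (𝓡 4) x) :=
  inferInstanceAs (FiniteDimensional ℝ E4)

/-- The right-hand side of the Koszul formula for `2 g(∇_X Y, Z)`. -/
def koszul (X Y Z : VF M) (x : M) : ℝ :=
  dirDeriv X (fun y => g.inner y (Y y) (Z y)) x
  + dirDeriv Y (fun y => g.inner y (Z y) (X y)) x
  - dirDeriv Z (fun y => g.inner y (X y) (Y y)) x
  + g.inner x (VectorField.mlieBracket (𝓡 4) X Y x) (Z x)
  - g.inner x (VectorField.mlieBracket (𝓡 4) Y Z x) (X x)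
  + g.inner x (VectorField.mlieBracket (𝓡 4) Z X x) (Y x)

/-- The standard basis of the tangent space at `x`, from the preferred chart at `x`. -/
def stdBasis (x : M) : Module.Basis (Fin 4) ℝ (TangentSpace (𝓡 4) x) :=
  (EuclideanSpace.basisFun (Fin 4) ℝ).toBasis

/-- The Levi-Civita derivative `∇_X Y` of the metric `g`: at `x`, the vector `u` for which
`2 g(u, Z x)` is given by the Koszul formula whenever `Z` is one of the four basis vectors at `x`,
extended to a neighbourhood of `x` with constant components in the preferred chart. -/
def leviCivita (X Y : VF M) : VF M := fun x =>
  ((g.bilin x).toDual (g.nondegenerate x)).symm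
    ((stdBasis x).constr ℝ fun i =>
      koszul g X Y (FiberBundle.extend E4 (stdBasis x i)) x / 2)

end Connection

/-! ### Distributions -/

/-- A field of linear subspaces of the tangent spaces. -/
abbrev Distribution (M : Type*) [TopologicalSpace M] [ChartedSpace E4 M] : Type _ :=
  (x : M) → Submodule ℝ (TangentSpace (𝓡 4) x)

section Sections

variable [IsManifold (𝓡 4) ∞ M]

/-- `X` is a smooth section of the distribution `D` over `V`. -/
structure IsSection (D : Distribution M) (X : VF M) (V : Set M) : Prop where
  smooth : SmoothVF X V
  mem : ∀ x ∈ V, X x ∈ D x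

/-- `D` is integrable on `U` (in the sense of Frobenius): the Lie bracket of two local sections of
`D` is again a local section of `D`. -/
def IsIntegrableOn (D : Distribution M) (U : Set M) : Prop :=
  ∀ V : Set M, IsOpen V → V ⊆ U → ∀ X Y : VF M, IsSection D X V → IsSection D Y V →
    ∀ x ∈ V, VectorField.mlieBracket (𝓡 4) X Y x ∈ D x

end Sections

section Metric

variable [IsManifold (𝓡 4) ∞ M] (g : NeutralMetric M)

/-- `D` is parallel on `U`: `∇_X Y` lies in `D` for every local section `Y` of `D` and every local
vector field `X`. -/
def IsParallelOn (D : Distribution M) (U : Set M) : Prop :=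
  ∀ V : Set M, IsOpen V → V ⊆ U → ∀ X Y : VF M, SmoothVF X V → IsSection D Y V →
    ∀ x ∈ V, leviCivita g X Y x ∈ D x

/-- `D` is auto-parallel on `U`: `∇_X Y` lies in `D` for all local sections `X`, `Y` of `D`. -/
def IsAutoParallelOn (D : Distribution M) (U : Set M) : Prop :=
  ∀ V : Set M, IsOpen V → V ⊆ U → ∀ X Y : VF M, IsSection D X V → IsSection D Y V →
    ∀ x ∈ V, leviCivita g X Y x ∈ D x

/-- The pointwise orthogonal complement of a distribution. -/
def perp (D : Distribution M) : Distribution M := fun x =>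
  LinearMap.BilinForm.orthogonal (g.bilin x) (D x)

/-- The distribution `𝓗 = 𝓓^⊥`, where `𝓓 = Z ∩ W`. -/
def distH (Z W : Distribution M) : Distribution M := perp g fun x => Z x ⊓ W x

end Metric

/-! ### Two-spinors

A local spinor field is given by its pair of components in a local spin frame. -/

/-- The spinor symbol `ε_{AB} = ε^{AB}`, with `ε_{01} = 1`. -/
def eps (A B : Fin 2) : ℝ := !![0, 1; -1, 0] A B

/-- Lowering an index: `λ_B = λ^A ε_{AB}`. -/
def lower (l : Fin 2 → ℝ) (B : Fin 2) : ℝ := ∑ A, l A * eps A B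

/-- The contraction `λ_A μ^A`. -/
def contract (l m : Fin 2 → ℝ) : ℝ := ∑ A, lower l A * m A

/-- The four vector fields `e_{AA'}` attached to a pair of local spin frames. -/
abbrev Frame (M : Type*) [TopologicalSpace M] [ChartedSpace E4 M] : Type _ :=
  Fin 2 → Fin 2 → VF M

/-- The tangent vector `μ^A ν^{A'}` at `x`. -/
def Frame.vec (e : Frame M) (x : M) (m n : Fin 2 → ℝ) : TangentSpace (𝓡 4) x :=
  ∑ A, ∑ A', (m A * n A') • e A A' x

section Spin

variable [IsManifold (𝓡 4) ∞ M] (g : NeutralMetric M)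

/-- `e` is a smooth spin frame over `U`: it identifies `S ⊗ S'` with the tangent spaces so that
`g_{ab} = ε_{AB} ε_{A'B'}`. Equivalently `(e_{00'}, e_{11'}, e_{01'}, e_{10'})` is a null tetrad
`(ℓ, n, m, m̃)` with `g(ℓ, n) = 1 = -g(m, m̃)`. -/
structure IsSpinFrame (e : Frame M) (U : Set M) : Prop where
  smooth : ∀ A A', SmoothVF (e A A') U
  inner_eq : ∀ x ∈ U, ∀ A A' B B', g.inner x (e A A' x) (e B B' x) = eps A B * eps A' B'

/-- The component `v^{AA'}` of a tangent vector in the frame `e`. -/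
def Frame.comp (e : Frame M) (x : M) (v : TangentSpace (𝓡 4) x) (A A' : Fin 2) : ℝ :=
  ∑ B, ∑ B', eps A B * eps A' B' * g.inner x v (e B B' x)

/-- The connection coefficients on unprimed spinors: the derivative along `X` of the `B`-th
element of the unprimed spin frame has `A`-th component `(1/2) (∇_X e_{BA'})^{AA'}`, summed over
`A'`. This is the connection induced on `S` by the Levi-Civita connection. -/
def Frame.spinCoeff (e : Frame M) (X : VF M) (x : M) (A B : Fin 2) : ℝ :=
  (1 / 2) * ∑ A', e.comp g x (leviCivita g X (e B A') x) A A'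

/-- The covariant derivative `∇_X λ^A` of an unprimed spinor field. -/
def Frame.spinDeriv (e : Frame M) (X : VF M) (l : M → Fin 2 → ℝ) (x : M) (A : Fin 2) : ℝ :=
  dirDeriv X (fun y => l y A) x + ∑ B, e.spinCoeff g X x A B * l x B

/-- The covector `S̃_b = λ_A ∇_b λ^A`, as `S̃_{BB'}`. -/
def Frame.tildeS (e : Frame M) (l : M → Fin 2 → ℝ) (x : M) (B B' : Fin 2) : ℝ :=
  contract (l x) (e.spinDeriv g (e B B') l x)

/-- `π^{A'}` is over `U` a scaled representative of the projective primed spinor field defining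
`Z`: smooth, nowhere zero, with `Z = {μ^A π^{A'}}`. In particular `Z` consists of `α`-planes. -/
structure IsRepAlpha (e : Frame M) (U : Set M) (Z : Distribution M) (p : M → Fin 2 → ℝ) :
    Prop where
  smooth : SmoothFn p U
  ne_zero : ∀ x ∈ U, p x ≠ 0
  mem_iff : ∀ x ∈ U, ∀ v, v ∈ Z x ↔ ∃ m, v = e.vec x m (p x)

/-- `λ^A` is over `U` a scaled representative of the projective unprimed spinor field defining
`W`: smooth, nowhere zero, with `W = {λ^A ν^{A'}}`. In particular `W` consists of `β`-planes. -/
structure IsRepBeta (e : Frame M) (U : Set M) (W : Distribution M) (l : M → Fin 2 → ℝ) :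
    Prop where
  smooth : SmoothFn l U
  ne_zero : ∀ x ∈ U, l x ≠ 0
  mem_iff : ∀ x ∈ U, ∀ v, v ∈ W x ↔ ∃ n, v = e.vec x (l x) n

/-- Local scaled representatives `π^{A'}`, `λ^A` of `[π^{A'}]`, `[λ^A]` over a common open set,
in a spin frame. -/
structure ScaledReps (Z W : Distribution M) where
  dom : Set M
  isOpen_dom : IsOpen dom
  e : Frame M
  isSpinFrame : IsSpinFrame g e dom
  p : M → Fin 2 → ℝ
  isRep_p : IsRepAlpha e dom Z p
  l : M → Fin 2 → ℝ
  isRep_l : IsRepBeta e dom W l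

/-- `Z` is an `α`-distribution and `W` a `β`-distribution: around each point, both are given by
projective spinor fields. -/
def IsAlphaBetaPair (Z W : Distribution M) : Prop :=
  ∀ x : M, ∃ R : ScaledReps g Z W, x ∈ R.dom

/-- A Walker geometry `(M, g, [π])` together with a `β`-distribution `W`: the `α`-distribution `Z`
is parallel. -/
structure IsWalkerWithBeta (Z W : Distribution M) : Prop where
  pair : IsAlphaBetaPair g Z W
  parallel : IsParallelOn g Z Set.univ

/-- A sesquiWalker `αβ`-geometry: moreover `W` is integrable. -/
structure IsSesquiWalker (Z W : Distribution M) : Prop extends IsWalkerWithBeta g Z W where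
  integrable : IsIntegrableOn W Set.univ

variable {g}

/-- `κ` is the smooth primed spinor field over the domain with `λ_A ∇_b λ^A = λ_B κ_{B'}`. -/
structure ScaledReps.IsKappa {Z W : Distribution M} (R : ScaledReps g Z W)
    (k : M → Fin 2 → ℝ) : Prop where
  smooth : SmoothFn k R.dom
  eq : ∀ x ∈ R.dom, ∀ B B', R.e.tildeS g R.l x B B' = lower (R.l x) B * lower (k x) B'

end Spin

end AlphaBeta

end

noncomputable section

namespace AlphaBeta

variable {M : Type*} [TopologicalSpace M] [ChartedSpace E4 M]

/-! ### Derivatives of functions along vector fields -/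

/-! Everything rests on one identity, `inner_leviCivita_eq_tildeSForm`: for spinor fields ν and a
constant spinor ρ, g(∇_X(λν), λρ) = -S̃(X) ν_{A'}ρ^{A'}. The covector S̃ thus measures how far ∇
moves W out of W, since W is its own orthogonal complement.

Torsion-freeness turns brackets into differences of covariant derivatives. Bracketing two sections
of W shows that W is integrable exactly when S̃ vanishes on W (`tildeSForm_W_eq_zero`,
`isIntegrableOn_W`). Bracketing a section of Z with one of W and pairing with λπ, the derivative of
the section of Z drops out because Z is parallel, so integrability of 𝓗 forces S̃ to vanish on Z
(`tildeSForm_Z_eq_zero`).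

Conversely 𝓗 = Z + W. If S̃ vanishes on it, then g(∇_X Y, λπ) = -g(∇_X(λπ), Y) is zero for sections
X, Y of 𝓗: the Z-part of Y is handled by parallelism and the W-part by the identity. Hence 𝓗 is even
auto-parallel (`isAutoParallelOn_distH`), which is stronger than integrable.

The rest is two-dimensional spinor algebra: vanishing on W means S̃_b = λ_B κ_{B'}, and vanishing on
Z then means that κ is a multiple of π. Rescaling uses that S̃ is quadratic in λ
(`Frame.tildeS_smul`). -/

/-- The function `f` is differentiable at `x`. -/
abbrev DiffAt (f : M → ℝ) (x : M) : Prop := MDifferentiableAt (𝓡 4) 𝓘(ℝ, ℝ) f x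

theorem dirDeriv_eq_mvfderiv (X : VF M) (f : M → ℝ) (x : M) :
    dirDeriv X f x = mvfderiv (𝓡 4) f x (X x) := rfl

theorem dirDeriv_add_left (X X' : VF M) (f : M → ℝ) (x : M) :
    dirDeriv (X + X') f x = dirDeriv X f x + dirDeriv X' f x := by
  simp only [dirDeriv_eq_mvfderiv, Pi.add_apply, map_add]

theorem dirDeriv_smul_left (a : M → ℝ) (X : VF M) (f : M → ℝ) (x : M) :
    dirDeriv (a • X) f x = a x * dirDeriv X f x := by
  simp only [dirDeriv_eq_mvfderiv, Pi.smul_apply', map_smul, smul_eq_mul]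

theorem dirDeriv_add (X : VF M) {f h : M → ℝ} {x : M} (hf : DiffAt f x) (hh : DiffAt h x) :
    dirDeriv X (fun y => f y + h y) x = dirDeriv X f x + dirDeriv X h x := by
  have := mvfderiv_add hf hh
  simp only [dirDeriv_eq_mvfderiv]
  change mvfderiv (𝓡 4) (f + h) x (X x) = _
  rw [this]; rfl

theorem dirDeriv_mul (X : VF M) {f h : M → ℝ} {x : M} (hf : DiffAt f x) (hh : DiffAt h x) :
    dirDeriv X (fun y => f y * h y) x = dirDeriv X f x * h x + f x * dirDeriv X h x := by
  have := mvfderiv_mul hf hh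
  simp only [dirDeriv_eq_mvfderiv]
  change mvfderiv (𝓡 4) (f * h) x (X x) = _
  rw [this]
  simp
  ring

theorem dirDeriv_const (X : VF M) (c : ℝ) (x : M) : dirDeriv X (fun _ => c) x = 0 := by
  simp [dirDeriv_eq_mvfderiv, mvfderiv_const]

theorem dirDeriv_congr (X : VF M) {f h : M → ℝ} {x : M} (e : f =ᶠ[nhds x] h) :
    dirDeriv X f x = dirDeriv X h x := by
  unfold dirDeriv
  rw [e.mfderiv_eq]
  rfl

theorem dirDeriv_sum (X : VF M) {ι : Type*} (s : Finset ι) {f : ι → M → ℝ} {x : M}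
    (hf : ∀ i ∈ s, DiffAt (f i) x) :
    DiffAt (fun y => ∑ i ∈ s, f i y) x ∧
      dirDeriv X (fun y => ∑ i ∈ s, f i y) x = ∑ i ∈ s, dirDeriv X (f i) x := by
  classical
  induction s using Finset.induction_on with
  | empty => simp [dirDeriv_const, mdifferentiableAt_const]
  | insert a s ha ih =>
    simp only [Finset.mem_insert, forall_eq_or_imp] at hf
    obtain ⟨h1, h2⟩ := ih hf.2
    simp only [Finset.sum_insert ha]
    exact ⟨hf.1.add h1, by rw [dirDeriv_add X hf.1 h1, h2]⟩

theorem SmoothFn.diffAt {f : M → ℝ} {U : Set M} (h : SmoothFn f U) (hU : IsOpen U) {x : M}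
    (hx : x ∈ U) : DiffAt f x :=
  (h.contMDiffAt (hU.mem_nhds hx)).mdifferentiableAt (by simp)

section LeviCivita

variable [IsManifold (𝓡 4) ∞ M]

/-! ### Differentiability of vector fields and of their scalar products -/

instance isManifold_one : IsManifold (𝓡 4) 1 M := .of_le (n := ∞) (by simp)

instance isManifold_two : IsManifold (𝓡 4) 2 M := .of_le (n := ∞) (by norm_cast)

instance isManifold_minSmoothness : IsManifold (𝓡 4) (minSmoothness ℝ 2) M := by
  simp only [minSmoothness_of_isRCLikeNormedField]; infer_instance

/-- The vector field `X` is differentiable at `x`. -/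
abbrev DiffVF (X : VF M) (x : M) : Prop :=
  MDifferentiableAt (𝓡 4) (𝓡 4).tangent (fun y => (⟨y, X y⟩ : TangentBundle (𝓡 4) M)) x

theorem SmoothVF.diffVF {X : VF M} {U : Set M} (h : SmoothVF X U) (hU : IsOpen U) {x : M}
    (hx : x ∈ U) : DiffVF X x :=
  (h.contMDiffAt (hU.mem_nhds hx)).mdifferentiableAt (by simp)

theorem DiffVF.add {X Y : VF M} {x : M} (hX : DiffVF X x) (hY : DiffVF Y x) :
    DiffVF (X + Y) x := mdifferentiableAt_add_section hX hY

theorem DiffVF.smul {f : M → ℝ} {X : VF M} {x : M} (hf : DiffAt f x) (hX : DiffVF X x) :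
    DiffVF (f • X) x := hf.smul_section hX

theorem diffVF_extend {x : M} (v : TangentSpace (𝓡 4) x) :
    DiffVF (FiberBundle.extend E4 v) x :=
  FiberBundle.mdifferentiableAt_extend ..

variable (g : NeutralMetric M)

theorem SmoothVF.inner {X Y : VF M} {U : Set M} (hX : SmoothVF X U) (hY : SmoothVF Y U) :
    SmoothFn (fun y => g.inner y (X y) (Y y)) U := by
  intro x hx
  have h : ContMDiffWithinAt (𝓡 4) ((𝓡 4).prod 𝓘(ℝ)) ∞
      (fun m => Bundle.TotalSpace.mk' ℝ (E := Bundle.Trivial M ℝ) m (g.inner m (X m) (Y m)))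
      U x := by
    apply ContMDiffWithinAt.clm_bundle_apply₂ (F₁ := E4) (F₂ := E4)
    · exact g.contMDiff.contMDiffAt.contMDiffWithinAt
    · exact hX x hx
    · exact hY x hx
  simp only [Bundle.contMDiffWithinAt_totalSpace] at h
  exact h.2

theorem DiffVF.inner {X Y : VF M} {x : M} (hX : DiffVF X x) (hY : DiffVF Y x) :
    DiffAt (fun y => g.inner y (X y) (Y y)) x := by
  have h : MDifferentiableAt (𝓡 4) ((𝓡 4).prod 𝓘(ℝ))
      (fun m => Bundle.TotalSpace.mk' ℝ (E := Bundle.Trivial M ℝ) m (g.inner m (X m) (Y m)))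
      x := by
    apply MDifferentiableAt.clm_bundle_apply₂ (F₁ := E4) (F₂ := E4)
    · exact g.contMDiff.mdifferentiableAt (by simp)
    · exact hX
    · exact hY
  simp only [mdifferentiableAt_totalSpace] at h
  exact h.2

/-! ### The Koszul formula -/

/-- Replacing Z by fZ produces the derivatives Xf and Yf once from a scalar product and once, with
opposite sign, from a bracket. This lets `leviCivita`, defined by testing against chart-constant
fields, be tested against any differentiable field. -/
theorem tensorialAt_koszul_right {X Y : VF M} {x : M} (hX : DiffVF X x) (hY : DiffVF Y x) :
    TensorialAt (𝓡 4) E4 (fun Z : VF M => koszul g X Y Z x) x where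
  smul {f Z} hf hZ := by
    have e1 : (fun y => g.inner y (Y y) ((f • Z) y)) = fun y => f y * g.inner y (Y y) (Z y) := by
      ext y; simp
    have e2 : (fun y => g.inner y ((f • Z) y) (X y)) = fun y => f y * g.inner y (Z y) (X y) := by
      ext y; simp
    simp only [koszul, e1, e2]
    rw [dirDeriv_mul X hf (hY.inner g hZ), dirDeriv_mul Y hf (DiffVF.inner g hZ hX),
      dirDeriv_smul_left, VectorField.mlieBracket_smul_right hf hZ,
      VectorField.mlieBracket_smul_left hf hZ, g.symm x (Y x) (Z x)]
    simp only [dirDeriv_eq_mvfderiv, map_add, map_smul, add_apply, smul_apply, smul_eq_mul,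
      Pi.smul_apply', neg_smul, map_neg, neg_apply]
    ring
  add {Z Z'} hZ hZ' := by
    have e1 : (fun y => g.inner y (Y y) ((Z + Z') y)) =
        fun y => g.inner y (Y y) (Z y) + g.inner y (Y y) (Z' y) := by ext y; simp
    have e2 : (fun y => g.inner y ((Z + Z') y) (X y)) =
        fun y => g.inner y (Z y) (X y) + g.inner y (Z' y) (X y) := by ext y; simp
    simp only [koszul, e1, e2]
    rw [dirDeriv_add X (hY.inner g hZ) (hY.inner g hZ'),
      dirDeriv_add Y (DiffVF.inner g hZ hX) (DiffVF.inner g hZ' hX),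
      dirDeriv_add_left, VectorField.mlieBracket_add_right hZ hZ',
      VectorField.mlieBracket_add_left hZ hZ']
    simp only [map_add, add_apply, Pi.add_apply]
    ring

theorem inner_leviCivita_extend (X Y : VF M) (x : M) (i : Fin 4) :
    g.inner x (leviCivita g X Y x) (stdBasis x i) =
      koszul g X Y (FiberBundle.extend E4 (stdBasis x i)) x / 2 := by
  set φ := (stdBasis x).constr ℝ fun i =>
      koszul g X Y (FiberBundle.extend E4 (stdBasis x i)) x / 2 with hφ
  have h := LinearMap.BilinForm.apply_toDual_symm_apply (hB := g.nondegenerate x) φ (stdBasis x i)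
  rw [hφ, Module.Basis.constr_basis] at h
  exact h

/-- The Koszul formula. -/
theorem inner_leviCivita {X Y Z : VF M} {x : M} (hX : DiffVF X x) (hY : DiffVF Y x)
    (hZ : DiffVF Z x) :
    g.inner x (leviCivita g X Y x) (Z x) = koszul g X Y Z x / 2 := by
  have hT := tensorialAt_koszul_right g hX hY
  have h1 : (g.inner x (leviCivita g X Y x) : TangentSpace (𝓡 4) x →ₗ[ℝ] ℝ) =
      (1 / 2 : ℝ) • (TensorialAt.mkHom _ x hT : TangentSpace (𝓡 4) x →ₗ[ℝ] ℝ) := by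
    refine (stdBasis x).ext fun i => ?_
    have := TensorialAt.mkHom_apply_eq_extend hT (stdBasis x i)
    simp only [ContinuousLinearMap.coe_coe, LinearMap.smul_apply, inner_leviCivita_extend]
    rw [this, smul_eq_mul]; ring
  have h2 := congrArg (fun φ => φ (Z x)) h1
  have := TensorialAt.mkHom_apply hT hZ
  simp only [ContinuousLinearMap.coe_coe, LinearMap.smul_apply] at h2
  rw [h2, this, smul_eq_mul]; ring

/-- The bracket terms cancel by antisymmetry and only the derivative along X survives. This is the
source of metric compatibility; the companion `koszul_sub_koszul_swap` is the source of vanishing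
torsion. -/
theorem koszul_add_koszul_swap (X Y Z : VF M) (x : M) :
    koszul g X Y Z x + koszul g X Z Y x = 2 * dirDeriv X (fun y => g.inner y (Y y) (Z y)) x := by
  unfold koszul
  rw [VectorField.mlieBracket_swap_apply (V := Z) (W := Y),
    VectorField.mlieBracket_swap_apply (V := Z) (W := X),
    VectorField.mlieBracket_swap_apply (V := Y) (W := X)]
  simp only [g.symm _ (Z _) (X _), g.symm _ (Y _) (X _), g.symm _ (Z _) (Y _), map_neg, neg_apply]
  ring

theorem koszul_sub_koszul_swap (X Y Z : VF M) (x : M) :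
    koszul g X Y Z x - koszul g Y X Z x =
      2 * g.inner x (VectorField.mlieBracket (𝓡 4) X Y x) (Z x) := by
  unfold koszul
  rw [VectorField.mlieBracket_swap_apply (V := Z) (W := Y),
    VectorField.mlieBracket_swap_apply (V := Z) (W := X),
    VectorField.mlieBracket_swap_apply (V := Y) (W := X)]
  simp only [g.symm _ (Z _) (X _), g.symm _ (Y _) (X _), g.symm _ (Z _) (Y _), map_neg, neg_apply]
  ring

/-- The Levi-Civita derivative is compatible with the metric. -/
theorem dirDeriv_inner {X Y Z : VF M} {x : M} (hX : DiffVF X x) (hY : DiffVF Y x)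
    (hZ : DiffVF Z x) :
    dirDeriv X (fun y => g.inner y (Y y) (Z y)) x =
      g.inner x (leviCivita g X Y x) (Z x) + g.inner x (leviCivita g X Z x) (Y x) := by
  rw [inner_leviCivita g hX hY hZ, inner_leviCivita g hX hZ hY]
  linarith [koszul_add_koszul_swap g X Y Z x]

theorem eq_of_inner_eq {x : M} {v w : TangentSpace (𝓡 4) x}
    (h : ∀ u, g.inner x v u = g.inner x w u) : v = w := by
  rw [← sub_eq_zero]
  refine g.eq_zero_of_inner fun u => ?_
  rw [map_sub, sub_apply, h u, sub_self]

/-- The Levi-Civita derivative is torsion-free. -/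
theorem mlieBracket_eq {X Y : VF M} {x : M} (hX : DiffVF X x) (hY : DiffVF Y x) :
    VectorField.mlieBracket (𝓡 4) X Y x = leviCivita g X Y x - leviCivita g Y X x := by
  refine eq_of_inner_eq g fun u => ?_
  have h := koszul_sub_koszul_swap g X Y (FiberBundle.extend E4 u) x
  have h1 := inner_leviCivita g hX hY (diffVF_extend u)
  have h2 := inner_leviCivita g hY hX (diffVF_extend u)
  rw [FiberBundle.extend_apply_self] at h h1 h2
  rw [map_sub, sub_apply]
  linarith

/-- As in the last slot, the derivatives of the factor cancel between scalar products and brackets.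
It makes ∇_X depend on X only through its value at the point, so that identities in X need checking
on a frame only. -/
theorem tensorialAt_koszul_left {Y Z : VF M} {x : M} (hY : DiffVF Y x) (hZ : DiffVF Z x) :
    TensorialAt (𝓡 4) E4 (fun X : VF M => koszul g X Y Z x) x where
  smul {f X} hf hX := by
    have e1 : (fun y => g.inner y (Z y) ((f • X) y)) = fun y => f y * g.inner y (Z y) (X y) := by
      ext y; simp
    have e2 : (fun y => g.inner y ((f • X) y) (Y y)) = fun y => f y * g.inner y (X y) (Y y) := by
      ext y; simp
    simp only [koszul, e1, e2]
    rw [dirDeriv_mul Y hf (hZ.inner g hX), dirDeriv_mul Z hf (DiffVF.inner g hX hY),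
      dirDeriv_smul_left, VectorField.mlieBracket_smul_right hf hX,
      VectorField.mlieBracket_smul_left hf hX, g.symm x (Z x) (X x)]
    simp only [dirDeriv_eq_mvfderiv, map_add, map_smul, add_apply, smul_apply, smul_eq_mul,
      Pi.smul_apply', neg_smul, map_neg, neg_apply]
    ring
  add {X X'} hX hX' := by
    have e1 : (fun y => g.inner y (Z y) ((X + X') y)) =
        fun y => g.inner y (Z y) (X y) + g.inner y (Z y) (X' y) := by ext y; simp
    have e2 : (fun y => g.inner y ((X + X') y) (Y y)) =
        fun y => g.inner y (X y) (Y y) + g.inner y (X' y) (Y y) := by ext y; simp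
    simp only [koszul, e1, e2]
    rw [dirDeriv_add Y (hZ.inner g hX) (hZ.inner g hX'),
      dirDeriv_add Z (DiffVF.inner g hX hY) (DiffVF.inner g hX' hY),
      dirDeriv_add_left, VectorField.mlieBracket_add_right hX hX',
      VectorField.mlieBracket_add_left hX hX']
    simp only [map_add, add_apply, Pi.add_apply]
    ring

/-- The Levi-Civita derivative along `X` depends linearly on the value of `X`. -/
theorem exists_linear_leviCivita {Y Z : VF M} {x : M} (hY : DiffVF Y x) (hZ : DiffVF Z x) :
    ∃ φ : TangentSpace (𝓡 4) x →ₗ[ℝ] ℝ, ∀ X : VF M, DiffVF X x →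
      g.inner x (leviCivita g X Y x) (Z x) = φ (X x) := by
  have hT := tensorialAt_koszul_left g hY hZ
  refine ⟨(1 / 2 : ℝ) • (TensorialAt.mkHom _ x hT : TangentSpace (𝓡 4) x →ₗ[ℝ] ℝ),
    fun X hX => ?_⟩
  have := TensorialAt.mkHom_apply hT hX
  simp only [ContinuousLinearMap.coe_coe, LinearMap.smul_apply]
  rw [this, inner_leviCivita g hX hY hZ, smul_eq_mul]; ring

end LeviCivita

end AlphaBeta

end

noncomputable section

namespace AlphaBeta

variable {M : Type*} [TopologicalSpace M] [ChartedSpace E4 M]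

/-! ### Smooth functions and vector fields -/

theorem SmoothFn.mono {F : Type*} [NormedAddCommGroup F] [NormedSpace ℝ F] {f : M → F}
    {U V : Set M} (h : SmoothFn f U) (hV : V ⊆ U) : SmoothFn f V := ContMDiffOn.mono h hV

theorem SmoothFn.add {f h : M → ℝ} {U : Set M} (hf : SmoothFn f U) (hh : SmoothFn h U) :
    SmoothFn (fun x => f x + h x) U := ContMDiffOn.add hf hh

theorem SmoothFn.sub {f h : M → ℝ} {U : Set M} (hf : SmoothFn f U) (hh : SmoothFn h U) :
    SmoothFn (fun x => f x - h x) U := ContMDiffOn.sub hf hh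

theorem SmoothFn.neg {f : M → ℝ} {U : Set M} (hf : SmoothFn f U) :
    SmoothFn (fun x => - f x) U := ContMDiffOn.neg hf

theorem SmoothFn.mul {f h : M → ℝ} {U : Set M} (hf : SmoothFn f U) (hh : SmoothFn h U) :
    SmoothFn (fun x => f x * h x) U := ContMDiffOn.mul hf hh

theorem SmoothFn.div {f h : M → ℝ} {U : Set M} (hf : SmoothFn f U) (hh : SmoothFn h U)
    (h0 : ∀ x ∈ U, h x ≠ 0) : SmoothFn (fun x => f x / h x) U := ContMDiffOn.div₀ hf hh h0

theorem smoothFn_const {F : Type*} [NormedAddCommGroup F] [NormedSpace ℝ F] (c : F) (U : Set M) :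
    SmoothFn (fun _ : M => c) U := contMDiffOn_const

theorem SmoothFn.sum {ι : Type*} (s : Finset ι) {f : ι → M → ℝ} {U : Set M}
    (h : ∀ i ∈ s, SmoothFn (f i) U) : SmoothFn (fun x => ∑ i ∈ s, f i x) U :=
  contMDiffOn_finsetSum h

theorem smoothFn_pi {ι : Type*} [Fintype ι] {f : M → ι → ℝ} {U : Set M} :
    SmoothFn f U ↔ ∀ i, SmoothFn (fun x => f x i) U := contMDiffOn_pi_space

theorem SmoothFn.congr {F : Type*} [NormedAddCommGroup F] [NormedSpace ℝ F] {f h : M → F}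
    {U : Set M} (hf : SmoothFn f U) (e : ∀ x ∈ U, h x = f x) : SmoothFn h U :=
  ContMDiffOn.congr hf e

theorem Frame.vec_smul_left (e : Frame M) (x : M) (c : ℝ) (m n : Fin 2 → ℝ) :
    e.vec x (c • m) n = c • e.vec x m n := by
  simp only [Frame.vec, Fin.sum_univ_two, Pi.smul_apply, smul_eq_mul]; module

theorem Frame.vec_smul_right (e : Frame M) (x : M) (c : ℝ) (m n : Fin 2 → ℝ) :
    e.vec x m (c • n) = c • e.vec x m n := by
  simp only [Frame.vec, Fin.sum_univ_two, Pi.smul_apply, smul_eq_mul]; module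

theorem Frame.vec_single (e : Frame M) (x : M) (A A' : Fin 2) :
    e.vec x (Pi.single A 1) (Pi.single A' 1) = e A A' x := by
  fin_cases A <;> fin_cases A' <;> simp [Frame.vec, Fin.sum_univ_two]

variable [IsManifold (𝓡 4) ∞ M]

theorem SmoothVF.mono {X : VF M} {U V : Set M} (h : SmoothVF X U) (hV : V ⊆ U) :
    SmoothVF X V := ContMDiffOn.mono h hV

theorem SmoothVF.smul {f : M → ℝ} {X : VF M} {U : Set M} (hf : SmoothFn f U)
    (hX : SmoothVF X U) : SmoothVF (f • X) U := ContMDiffOn.smul_section hf hX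

theorem SmoothVF.sum {ι : Type*} (s : Finset ι) {X : ι → VF M} {U : Set M}
    (h : ∀ i ∈ s, SmoothVF (X i) U) : SmoothVF (fun x => ∑ i ∈ s, X i x) U :=
  ContMDiffOn.sum_section h

theorem SmoothVF.mlieBracket {X Y : VF M} {U : Set M} (hU : IsOpen U) (hX : SmoothVF X U)
    (hY : SmoothVF Y U) : SmoothVF (VectorField.mlieBracket (𝓡 4) X Y) U := by
  intro x hx
  -- The bracket costs one derivative, harmless because ∞ + 1 = ∞.
  have : IsManifold (𝓡 4) (((⊤ : ℕ∞) : WithTop ℕ∞) + 1) M := by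
    have : ((⊤ : ℕ∞) : WithTop ℕ∞) + 1 = ∞ := by norm_cast
    rw [this]; infer_instance
  exact (ContMDiffAt.mlieBracket_vectorField (m := ⊤) (n := ⊤) (hX.contMDiffAt (hU.mem_nhds hx))
    (hY.contMDiffAt (hU.mem_nhds hx)) (by simp)).contMDiffWithinAt

/-! ### Spin frames -/

theorem lower_zero (l : Fin 2 → ℝ) : lower l 0 = - l 1 := by
  simp [lower, eps, Fin.sum_univ_two]

theorem lower_one (l : Fin 2 → ℝ) : lower l 1 = l 0 := by
  simp [lower, eps, Fin.sum_univ_two]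

theorem lower_smul (c : ℝ) (l : Fin 2 → ℝ) (B : Fin 2) : lower (c • l) B = c * lower l B := by
  fin_cases B <;> simp [lower_zero, lower_one]

theorem contract_eq (l m : Fin 2 → ℝ) : contract l m = l 0 * m 1 - l 1 * m 0 := by
  simp only [contract, Fin.sum_univ_two, lower_zero, lower_one]; ring

theorem sq_add_sq_pos {l : Fin 2 → ℝ} (h : l ≠ 0) : 0 < l 0 ^ 2 + l 1 ^ 2 := by
  rcases Function.ne_iff.1 h with ⟨i, hi⟩
  simp only [Pi.zero_apply] at hi
  fin_cases i <;> simp only [Fin.zero_eta, Fin.mk_one] at hi <;> positivity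

section

variable {g : NeutralMetric M} {e : Frame M} {U : Set M} {x : M}

theorem Frame.smoothVF_vec (h : IsSpinFrame g e U) {m n : M → Fin 2 → ℝ}
    (hm : SmoothFn m U) (hn : SmoothFn n U) : SmoothVF (fun x => e.vec x (m x) (n x)) U := by
  unfold Frame.vec
  refine SmoothVF.sum _ fun A _ => SmoothVF.sum _ fun A' _ => ?_
  exact SmoothVF.smul ((smoothFn_pi.1 hm A).mul (smoothFn_pi.1 hn A')) (h.smooth A A')

theorem IsSpinFrame.inner_vec (h : IsSpinFrame g e U) (hx : x ∈ U) (m n m' n' : Fin 2 → ℝ) :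
    g.inner x (e.vec x m n) (e.vec x m' n') = contract m m' * contract n n' := by
  simp only [Frame.vec, Fin.sum_univ_two, map_add, map_smul, add_apply, smul_apply, h.inner_eq x hx,
    contract_eq, smul_eq_mul]
  simp [eps]
  ring

theorem IsSpinFrame.comp_vec (h : IsSpinFrame g e U) (hx : x ∈ U) (m n : Fin 2 → ℝ)
    (A A' : Fin 2) : e.comp g x (e.vec x m n) A A' = m A * n A' := by
  simp only [Frame.comp, ← e.vec_single x, h.inner_vec hx, Fin.sum_univ_two, contract_eq]
  fin_cases A <;> fin_cases A' <;> simp [eps]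

theorem Frame.comp_add (v w : TangentSpace (𝓡 4) x) (A A' : Fin 2) :
    e.comp g x (v + w) A A' = e.comp g x v A A' + e.comp g x w A A' := by
  simp only [Frame.comp, map_add, add_apply, Fin.sum_univ_two]; ring

theorem Frame.comp_smul (c : ℝ) (v : TangentSpace (𝓡 4) x) (A A' : Fin 2) :
    e.comp g x (c • v) A A' = c * e.comp g x v A A' := by
  simp only [Frame.comp, map_smul, smul_apply, smul_eq_mul, Fin.sum_univ_two]; ring

variable (g e x) in
/-- The component `v^{AA'}` as a linear form in `v`. -/
def Frame.compForm (A A' : Fin 2) : TangentSpace (𝓡 4) x →ₗ[ℝ] ℝ where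
  toFun v := e.comp g x v A A'
  map_add' v w := e.comp_add v w A A'
  map_smul' c v := e.comp_smul c v A A'

theorem IsSpinFrame.comp_frame (h : IsSpinFrame g e U) (hx : x ∈ U) (A A' B B' : Fin 2) :
    e.comp g x (e B B' x) A A' = if B = A ∧ B' = A' then 1 else 0 := by
  rw [← e.vec_single x, h.comp_vec hx]
  fin_cases A <;> fin_cases A' <;> fin_cases B <;> fin_cases B' <;> simp

/-- The component forms are dual to the frame. -/
theorem IsSpinFrame.linearIndependent (h : IsSpinFrame g e U) (hx : x ∈ U) :
    LinearIndependent ℝ (fun i : Fin 2 × Fin 2 => e i.1 i.2 x) := by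
  rw [Fintype.linearIndependent_iff]
  intro c hc i
  have := congrArg (e.compForm g x i.1 i.2) hc
  simp only [map_sum, map_smul, map_zero, smul_eq_mul] at this
  rw [Finset.sum_eq_single i] at this
  · have h1 : e.compForm g x i.1 i.2 (e i.1 i.2 x) = 1 := by
      simp [Frame.compForm, h.comp_frame hx]
    rwa [h1, mul_one] at this
  · intro j _ hj
    have h1 : e.compForm g x i.1 i.2 (e j.1 j.2 x) = 0 := by
      simp only [Frame.compForm, LinearMap.coe_mk, AddHom.coe_mk, h.comp_frame hx]
      rw [if_neg]
      rintro ⟨h1, h2⟩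
      exact hj (Prod.ext h1 h2)
    rw [h1, mul_zero]
  · simp

theorem IsSpinFrame.linearMap_ext (h : IsSpinFrame g e U) (hx : x ∈ U) {F : Type*}
    [AddCommGroup F] [Module ℝ F] {φ ψ : TangentSpace (𝓡 4) x →ₗ[ℝ] F}
    (H : ∀ A A', φ (e A A' x) = ψ (e A A' x)) : φ = ψ := by
  have hc : Fintype.card (Fin 2 × Fin 2) = Module.finrank ℝ (TangentSpace (𝓡 4) x) := by
    have : Module.finrank ℝ (TangentSpace (𝓡 4) x) = Module.finrank ℝ E4 := rfl
    rw [this]; simp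
  refine (basisOfLinearIndependentOfCardEqFinrank (h.linearIndependent hx) hc).ext fun i => ?_
  simpa using H i.1 i.2

theorem IsSpinFrame.eq_sum_comp (h : IsSpinFrame g e U) (hx : x ∈ U)
    (v : TangentSpace (𝓡 4) x) : ∑ A, ∑ A', e.comp g x v A A' • e A A' x = v := by
  have := h.linearMap_ext hx (φ := ∑ A, ∑ A', (e.compForm g x A A').smulRight (e A A' x))
    (ψ := LinearMap.id) (by
      intro B B'
      fin_cases B <;> fin_cases B' <;>
        simp [Fin.sum_univ_two, Frame.compForm, h.comp_frame hx])
  have h2 := congrArg (fun φ => φ v) this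
  simpa [Frame.compForm] using h2

theorem IsSpinFrame.ext_comp (h : IsSpinFrame g e U) (hx : x ∈ U)
    {v w : TangentSpace (𝓡 4) x} (H : ∀ A A', e.comp g x v A A' = e.comp g x w A A') : v = w := by
  rw [← h.eq_sum_comp hx v, ← h.eq_sum_comp hx w]
  simp only [H]

theorem IsSpinFrame.inner_eq_comp (h : IsSpinFrame g e U) (hx : x ∈ U)
    (v : TangentSpace (𝓡 4) x) (m n : Fin 2 → ℝ) :
    g.inner x v (e.vec x m n) = ∑ A, ∑ A', e.comp g x v A A' * (lower m A * lower n A') := by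
  conv_lhs => rw [← h.eq_sum_comp hx v]
  simp only [← e.vec_single x, map_sum, sum_apply, map_smul, smul_apply, h.inner_vec hx, smul_eq_mul]
  refine Finset.sum_congr rfl fun A _ => Finset.sum_congr rfl fun A' _ => ?_
  congr 1
  fin_cases A <;> fin_cases A' <;> simp [contract_eq, lower_zero, lower_one]

/-- The `β`-plane of `l` is its own orthogonal complement. -/
theorem IsSpinFrame.exists_eq_vec (h : IsSpinFrame g e U) (hx : x ∈ U) {l : Fin 2 → ℝ}
    (hl : l ≠ 0) {v : TangentSpace (𝓡 4) x}
    (H : ∀ i : Fin 2, g.inner x v (e.vec x l (Pi.single i 1)) = 0) : ∃ n, v = e.vec x l n := by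
  have hN := (sq_add_sq_pos hl).ne'
  -- With the components of v as a matrix c and P the Euclidean projection onto l, the witness gives
  -- the matrix Pc. The hypothesis says that the lowered l, which is Euclidean-orthogonal to l,
  -- annihilates c from the left, so c = Pc.
  refine ⟨fun A' => (e.comp g x v 0 A' * l 0 + e.comp g x v 1 A' * l 1) / (l 0 ^ 2 + l 1 ^ 2),
    h.ext_comp hx fun A A' => ?_⟩
  have H0 := H 0
  have H1 := H 1
  simp only [h.inner_eq_comp hx, Fin.sum_univ_two, lower_zero, lower_one] at H0 H1
  simp at H0 H1
  rw [h.comp_vec hx, ← mul_div_assoc, eq_div_iff hN]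
  fin_cases A <;> fin_cases A' <;> simp only [Fin.zero_eta, Fin.mk_one]
  · linear_combination (l 1) * H1
  · linear_combination (-l 1) * H0
  · linear_combination (-l 0) * H1
  · linear_combination (l 0) * H0

/-- The orthogonal complement of `l^A p^{A'}` is spanned by the `α`-plane of `p` and the
`β`-plane of `l`. -/
theorem IsSpinFrame.exists_eq_vec_add_vec (h : IsSpinFrame g e U) (hx : x ∈ U)
    {l p : Fin 2 → ℝ} (hl : l ≠ 0) (hp : p ≠ 0) {v : TangentSpace (𝓡 4) x}
    (H : g.inner x v (e.vec x l p) = 0) : ∃ m n, v = e.vec x m p + e.vec x l n := by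
  have hL := (sq_add_sq_pos hl).ne'
  have hP := (sq_add_sq_pos hp).ne'
  simp only [h.inner_eq_comp hx, Fin.sum_univ_two, lower_zero, lower_one] at H
  set c := e.comp g x v with hc
  set N := l 0 ^ 2 + l 1 ^ 2 with hN
  set Q := p 0 ^ 2 + p 1 ^ 2 with hQ
  -- For Euclidean projections P onto l and P' onto p, c = cP' + (Pc - PcP') + (1-P)c(1-P'). The
  -- first two summands are the two witnesses, and `H` says that the last one vanishes.
  refine ⟨fun A => (c A 0 * p 0 + c A 1 * p 1) / Q,
    fun A' => (l 0 * c 0 A' + l 1 * c 1 A') / N -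
      (∑ A, ∑ B', l A * c A B' * p B') * p A' / (N * Q), h.ext_comp hx fun A A' => ?_⟩
  rw [Frame.comp_add, h.comp_vec hx, h.comp_vec hx, ← hc]
  simp only [Fin.sum_univ_two]
  field_simp
  fin_cases A <;> fin_cases A' <;> simp only [Fin.zero_eta, Fin.mk_one, hN, hQ]
  · linear_combination (l 1 * p 1) * H
  · linear_combination (-l 1 * p 0) * H
  · linear_combination (-l 0 * p 1) * H
  · linear_combination (l 0 * p 0) * H

end

end AlphaBeta

end

noncomputable section

namespace AlphaBeta

variable {M : Type*} [TopologicalSpace M] [ChartedSpace E4 M] [IsManifold (𝓡 4) ∞ M]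
  {g : NeutralMetric M} {e : Frame M} {U : Set M} {x : M}

/-! ### The connection on spinors -/

/-- Smoothness of Xf is read off from that of brackets: [X, f e₀₀] = (Xf) e₀₀ + f [X, e₀₀], and
pairing with e₁₁ isolates Xf because g(e₀₀, e₁₁) = 1. -/
theorem IsSpinFrame.smoothFn_dirDeriv (h : IsSpinFrame g e U) (hU : IsOpen U) {X : VF M}
    (hX : SmoothVF X U) {f : M → ℝ} (hf : SmoothFn f U) : SmoothFn (dirDeriv X f) U := by
  have h0 := h.smooth 0 0
  have h1 := h.smooth 1 1
  refine (((hX.mlieBracket hU (h0.smul hf)).inner g h1).sub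
    (hf.mul ((hX.mlieBracket hU h0).inner g h1))).congr fun x hx => ?_
  rw [VectorField.mlieBracket_smul_right (hf.diffAt hU hx) (h0.diffVF hU hx), map_add, map_smul,
    map_smul, add_apply, smul_apply, smul_apply, h.inner_eq x hx, dirDeriv_eq_mvfderiv]
  simp [eps]

theorem IsSpinFrame.smoothFn_inner_leviCivita (h : IsSpinFrame g e U) (hU : IsOpen U)
    {X Y Z : VF M} (hX : SmoothVF X U) (hY : SmoothVF Y U) (hZ : SmoothVF Z U) :
    SmoothFn (fun x => g.inner x (leviCivita g X Y x) (Z x)) U := by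
  have hk : SmoothFn (koszul g X Y Z) U :=
    (((((h.smoothFn_dirDeriv hU hX (hY.inner g hZ)).add
      (h.smoothFn_dirDeriv hU hY (hZ.inner g hX))).sub
      (h.smoothFn_dirDeriv hU hZ (hX.inner g hY))).add
      ((hX.mlieBracket hU hY).inner g hZ)).sub ((hY.mlieBracket hU hZ).inner g hX)).add
      ((hZ.mlieBracket hU hX).inner g hY)
  exact (hk.mul (smoothFn_const (1 / 2) U)).congr fun x hx => by
    rw [inner_leviCivita g (hX.diffVF hU hx) (hY.diffVF hU hx) (hZ.diffVF hU hx)]; ring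

theorem IsSpinFrame.smoothFn_tildeS (h : IsSpinFrame g e U) (hU : IsOpen U)
    {l : M → Fin 2 → ℝ} (hl : SmoothFn l U) (B B' : Fin 2) :
    SmoothFn (fun x => e.tildeS g l x B B') U := by
  have hX := h.smooth B B'
  have hl' := smoothFn_pi.1 hl
  have hc : ∀ A C, SmoothFn (fun x => e.spinCoeff g (e B B') x A C) U := fun A C =>
    (smoothFn_const _ U).mul (SmoothFn.sum _ fun A' _ => SmoothFn.sum _ fun D _ =>
      SmoothFn.sum _ fun D' _ => (smoothFn_const _ U).mul
        (h.smoothFn_inner_leviCivita hU hX (h.smooth C A') (h.smooth D D')))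
  have hd : ∀ A, SmoothFn (fun x => e.spinDeriv g (e B B') l x A) U := fun A =>
    (h.smoothFn_dirDeriv hU hX (hl' A)).add (SmoothFn.sum _ fun C _ => (hc A C).mul (hl' C))
  refine (((hl' 0).mul (hd 1)).sub ((hl' 1).mul (hd 0))).congr fun x _ => ?_
  rw [Frame.tildeS, contract_eq]

/-- The derivative of the factor drops out because λ_A λ^A = 0. -/
theorem Frame.tildeS_smul (e : Frame M) (hU : IsOpen U) (hx : x ∈ U) {f : M → ℝ}
    {l : M → Fin 2 → ℝ} (hf : SmoothFn f U) (hl : SmoothFn l U) (B B' : Fin 2) :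
    e.tildeS g (fun y => f y • l y) x B B' = f x ^ 2 * e.tildeS g l x B B' := by
  have hl' := fun A => (smoothFn_pi.1 hl A).diffAt hU hx
  simp only [Frame.tildeS, contract_eq, Frame.spinDeriv, Pi.smul_apply, smul_eq_mul,
    dirDeriv_mul _ (hf.diffAt hU hx) (hl' _), Fin.sum_univ_two]
  ring

/-- Scalar products of frame fields are constant, so metric compatibility makes the connection
matrix skew. -/
theorem IsSpinFrame.inner_leviCivita_antisymm (h : IsSpinFrame g e U) (hU : IsOpen U)
    (hx : x ∈ U) {X : VF M} (hX : DiffVF X x) (A A' B B' : Fin 2) :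
    g.inner x (leviCivita g X (e A A') x) (e B B' x) =
      - g.inner x (leviCivita g X (e B B') x) (e A A' x) := by
  have h1 := dirDeriv_inner g hX ((h.smooth A A').diffVF hU hx) ((h.smooth B B').diffVF hU hx)
  rw [dirDeriv_congr (h := fun _ => eps A B * eps A' B') X
    (Filter.eventually_of_mem (hU.mem_nhds hx) fun y hy => h.inner_eq y hy A A' B B'),
    dirDeriv_const] at h1
  linarith

/-- The Leibniz rule in components. It comes from differentiating the scalar product with a frame
field by metric compatibility, then using skewness to move the derivative back onto the other frame
field. -/
theorem IsSpinFrame.inner_leviCivita_vec (h : IsSpinFrame g e U) (hU : IsOpen U) (hx : x ∈ U)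
    {X : VF M} (hX : DiffVF X x) {m n : M → Fin 2 → ℝ} (hm : SmoothFn m U) (hn : SmoothFn n U)
    (B B' : Fin 2) :
    g.inner x (leviCivita g X (fun y => e.vec y (m y) (n y)) x) (e B B' x) =
      ∑ A, ∑ A', ((dirDeriv X (fun y => m y A) x * n x A' + m x A * dirDeriv X (fun y => n y A') x)
        * (eps A B * eps A' B') +
        m x A * n x A' * g.inner x (leviCivita g X (e A A') x) (e B B' x)) := by
  have hY := (Frame.smoothVF_vec h hm hn).diffVF hU hx
  have hB := (h.smooth B B').diffVF hU hx
  have hm' := fun A => (smoothFn_pi.1 hm A).diffAt hU hx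
  have hn' := fun A => (smoothFn_pi.1 hn A).diffAt hU hx
  have h1 := dirDeriv_inner g hX hY hB
  have hterm : ∀ A A', DiffAt (fun y => m y A * n y A' * (eps A B * eps A' B')) x := fun A A' =>
    (((smoothFn_pi.1 hm A).mul (smoothFn_pi.1 hn A')).mul (smoothFn_const _ U)).diffAt hU hx
  rw [dirDeriv_congr (h := fun y => ∑ A, ∑ A', m y A * n y A' * (eps A B * eps A' B')) X
    (Filter.eventually_of_mem (hU.mem_nhds hx) fun y hy => ?_),
    (dirDeriv_sum X _ fun A _ => (dirDeriv_sum X _ fun A' _ => hterm A A').1).2] at h1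
  · have h2 : ∀ A A', dirDeriv X (fun y => m y A * n y A' * (eps A B * eps A' B')) x =
        (dirDeriv X (fun y => m y A) x * n x A' + m x A * dirDeriv X (fun y => n y A') x)
          * (eps A B * eps A' B') := fun A A' => by
      rw [dirDeriv_mul X (((smoothFn_pi.1 hm A).mul (smoothFn_pi.1 hn A')).diffAt hU hx)
        mdifferentiableAt_const, dirDeriv_mul X (hm' A) (hn' A'), dirDeriv_const]
      ring
    simp only [(dirDeriv_sum X _ fun A' _ => hterm _ A').2, h2] at h1
    rw [← sub_eq_iff_eq_add] at h1
    rw [← h1]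
    simp only [Finset.sum_add_distrib, sub_eq_add_neg]
    congr 1
    simp only [Frame.vec, map_sum, map_smul, smul_eq_mul, ← Finset.sum_neg_distrib]
    refine Finset.sum_congr rfl fun A _ => Finset.sum_congr rfl fun A' _ => ?_
    rw [h.inner_leviCivita_antisymm hU hx hX A A' B B']
    ring
  · simp only [Frame.vec, map_sum, map_smul, sum_apply, smul_apply,
      h.inner_eq y hy, smul_eq_mul]

/-- The spinor form `λ_A ∇_X λ^A` computed from the Levi-Civita derivative. -/
theorem IsSpinFrame.inner_leviCivita_beta (h : IsSpinFrame g e U) (hU : IsOpen U) (hx : x ∈ U)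
    {X : VF M} (hX : DiffVF X x) {l n : M → Fin 2 → ℝ} (hl : SmoothFn l U) (hn : SmoothFn n U)
    (r : Fin 2 → ℝ) :
    g.inner x (leviCivita g X (fun y => e.vec y (l y) (n y)) x) (e.vec x (l x) r) =
      - (contract (l x) (e.spinDeriv g X l x) * contract (n x) r) := by
  have anti := h.inner_leviCivita_antisymm hU hx hX
  have key := h.inner_leviCivita_vec hU hx hX hl hn
  have hd : ∀ A A', g.inner x (leviCivita g X (e A A') x) (e A A' x) = 0 := fun A A' => by
    linarith [anti A A' A A']
  conv_lhs => rw [Frame.vec]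
  simp only [map_sum, map_smul, key]
  simp only [contract_eq, Frame.spinDeriv, Frame.spinCoeff, Frame.comp, Fin.sum_univ_two,
    smul_eq_mul]
  -- Skewness reduces the sixteen connection coefficients to six independent ones, after which the
  -- identity is polynomial.
  simp only [hd, anti 1 1 0 0, anti 1 1 0 1, anti 1 1 1 0, anti 1 0 0 0, anti 1 0 0 1, anti 0 1 0 0]
  simp [eps]
  ring

theorem Frame.tildeS_eq (e : Frame M) (l : M → Fin 2 → ℝ) (x : M) (B B' : Fin 2) :
    e.tildeS g l x B B' = contract (l x) (e.spinDeriv g (e B B') l x) := rfl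

variable (g e x) in
/-- The covector `λ_A ∇_b λ^A` as a linear form on the tangent space. -/
def Frame.tildeSForm (l : M → Fin 2 → ℝ) : TangentSpace (𝓡 4) x →ₗ[ℝ] ℝ :=
  ∑ B, ∑ B', e.tildeS g l x B B' • e.compForm g x B B'

theorem IsSpinFrame.tildeSForm_vec (h : IsSpinFrame g e U) (hx : x ∈ U) (l : M → Fin 2 → ℝ)
    (m n : Fin 2 → ℝ) :
    e.tildeSForm g x l (e.vec x m n) = ∑ B, ∑ B', e.tildeS g l x B B' * (m B * n B') := by
  simp [Frame.tildeSForm, Frame.compForm, h.comp_vec hx, Fin.sum_univ_two]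

/-- Both sides are linear in the value of X, so the formula for X a frame field suffices. This is
the bridge between ∇ and S̃ used by all integrability arguments. -/
theorem IsSpinFrame.inner_leviCivita_eq_tildeSForm (h : IsSpinFrame g e U) (hU : IsOpen U)
    (hx : x ∈ U) {X : VF M} (hX : DiffVF X x) {l n : M → Fin 2 → ℝ} (hl : SmoothFn l U)
    (hn : SmoothFn n U) (r : Fin 2 → ℝ) :
    g.inner x (leviCivita g X (fun y => e.vec y (l y) (n y)) x) (e.vec x (l x) r) =
      - (e.tildeSForm g x l (X x) * contract (n x) r) := by
  obtain ⟨φ, hφ⟩ := exists_linear_leviCivita g ((Frame.smoothVF_vec h hl hn).diffVF hU hx)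
    ((Frame.smoothVF_vec h hl (smoothFn_const r U)).diffVF hU hx)
  have h1 : φ = - (contract (n x) r) • e.tildeSForm g x l := by
    refine h.linearMap_ext hx fun B B' => ?_
    have hB := (h.smooth B B').diffVF hU hx
    rw [← hφ _ hB, h.inner_leviCivita_beta hU hx hB hl hn, ← Frame.tildeS_eq]
    conv_rhs => rw [LinearMap.smul_apply, ← e.vec_single x, h.tildeSForm_vec hx]
    fin_cases B <;> fin_cases B' <;> simp [Fin.sum_univ_two] <;> ring
  rw [hφ X hX, h1, LinearMap.smul_apply, smul_eq_mul]
  ring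

end AlphaBeta

end

noncomputable section

namespace AlphaBeta

variable {M : Type*} [TopologicalSpace M] [ChartedSpace E4 M] [IsManifold (𝓡 4) ∞ M]
  {g : NeutralMetric M} {Z W : Distribution M}

/-! ### Locality -/

theorem IsSection.mono {D : Distribution M} {X : VF M} {U V : Set M} (h : IsSection D X U)
    (hV : V ⊆ U) : IsSection D X V := ⟨h.smooth.mono hV, fun x hx => h.mem x (hV hx)⟩

theorem IsIntegrableOn.mono {D : Distribution M} {U V : Set M} (h : IsIntegrableOn D U)
    (hV : V ⊆ U) : IsIntegrableOn D V := fun V' hV' hs => h V' hV' (hs.trans hV)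

theorem isIntegrableOn_of_locally {D : Distribution M} {U : Set M}
    (h : ∀ x ∈ U, ∃ V, IsOpen V ∧ x ∈ V ∧ IsIntegrableOn D (V ∩ U)) : IsIntegrableOn D U := by
  intro V hV hVU X Y hX hY x hx
  obtain ⟨V', hV', hxV', hD⟩ := h x (hVU hx)
  exact hD (V' ∩ V) (hV'.inter hV) (Set.inter_subset_inter_right _ hVU) X Y
    (hX.mono Set.inter_subset_right) (hY.mono Set.inter_subset_right) x ⟨hxV', hx⟩

theorem isAutoParallelOn_of_locally {D : Distribution M} {U : Set M}
    (h : ∀ x ∈ U, ∃ V, IsOpen V ∧ x ∈ V ∧ IsAutoParallelOn g D (V ∩ U)) :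
    IsAutoParallelOn g D U := by
  intro V hV hVU X Y hX hY x hx
  obtain ⟨V', hV', hxV', hD⟩ := h x (hVU hx)
  exact hD (V' ∩ V) (hV'.inter hV) (Set.inter_subset_inter_right _ hVU) X Y
    (hX.mono Set.inter_subset_right) (hY.mono Set.inter_subset_right) x ⟨hxV', hx⟩

theorem IsAutoParallelOn.isIntegrableOn {D : Distribution M} {U : Set M}
    (h : IsAutoParallelOn g D U) : IsIntegrableOn D U := by
  intro V hV hVU X Y hX hY x hx
  rw [mlieBracket_eq g (hX.smooth.diffVF hV hx) (hY.smooth.diffVF hV hx)]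
  exact (D x).sub_mem (h V hV hVU X Y hX hY x hx) (h V hV hVU Y X hY hX x hx)

/-- If `Y ⊥ T` on an open set, then differentiation moves from `Y` to `T`. -/
theorem inner_leviCivita_swap {X Y T : VF M} {V : Set M} (hV : IsOpen V) {x : M} (hx : x ∈ V)
    (hX : DiffVF X x) (hY : DiffVF Y x) (hT : DiffVF T x)
    (h : ∀ y ∈ V, g.inner y (Y y) (T y) = 0) :
    g.inner x (leviCivita g X Y x) (T x) = - g.inner x (leviCivita g X T x) (Y x) := by
  have h1 := dirDeriv_inner g hX hY hT
  rw [dirDeriv_congr (h := fun _ => 0) X (Filter.eventually_of_mem (hV.mem_nhds hx) h),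
    dirDeriv_const] at h1
  linarith

/-! ### The distributions in terms of spinors -/

namespace ScaledReps

variable (R : ScaledReps g Z W) {x : M}

theorem mem_Z (hx : x ∈ R.dom) (m : Fin 2 → ℝ) : R.e.vec x m (R.p x) ∈ Z x :=
  (R.isRep_p.mem_iff x hx _).2 ⟨m, rfl⟩

theorem mem_W (hx : x ∈ R.dom) (n : Fin 2 → ℝ) : R.e.vec x (R.l x) n ∈ W x :=
  (R.isRep_l.mem_iff x hx _).2 ⟨n, rfl⟩

theorem inner_Z (hx : x ∈ R.dom) {v w : TangentSpace (𝓡 4) x} (hv : v ∈ Z x) (hw : w ∈ Z x) :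
    g.inner x v w = 0 := by
  obtain ⟨m, rfl⟩ := (R.isRep_p.mem_iff x hx _).1 hv
  obtain ⟨m', rfl⟩ := (R.isRep_p.mem_iff x hx _).1 hw
  rw [R.isSpinFrame.inner_vec hx, contract_eq (R.p x)]
  ring

theorem inner_W (hx : x ∈ R.dom) {v w : TangentSpace (𝓡 4) x} (hv : v ∈ W x) (hw : w ∈ W x) :
    g.inner x v w = 0 := by
  obtain ⟨m, rfl⟩ := (R.isRep_l.mem_iff x hx _).1 hv
  obtain ⟨m', rfl⟩ := (R.isRep_l.mem_iff x hx _).1 hw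
  rw [R.isSpinFrame.inner_vec hx, contract_eq (R.l x)]
  ring

theorem mem_W_of_inner (hx : x ∈ R.dom) {v : TangentSpace (𝓡 4) x}
    (h : ∀ i : Fin 2, g.inner x v (R.e.vec x (R.l x) (Pi.single i 1)) = 0) : v ∈ W x :=
  (R.isRep_l.mem_iff x hx _).2 (R.isSpinFrame.exists_eq_vec hx (R.isRep_l.ne_zero x hx) h)

theorem mem_distH_iff (hx : x ∈ R.dom) (v : TangentSpace (𝓡 4) x) :
    v ∈ distH g Z W x ↔ g.inner x v (R.e.vec x (R.l x) (R.p x)) = 0 := by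
  have hdef : v ∈ distH g Z W x ↔ ∀ w ∈ Z x ⊓ W x, g.inner x w v = 0 := Iff.rfl
  rw [hdef]
  constructor
  · intro h
    rw [g.symm]
    exact h _ ⟨R.mem_Z hx _, R.mem_W hx _⟩
  · rintro h w ⟨hw1, hw2⟩
    obtain ⟨m, rfl⟩ := (R.isRep_p.mem_iff x hx _).1 hw1
    obtain ⟨n, hn⟩ := (R.isRep_l.mem_iff x hx _).1 hw2
    obtain ⟨i, hi⟩ := Function.ne_iff.1 (R.isRep_p.ne_zero x hx)
    -- A vector in both planes has components m^A π^{A'} = λ^A n^{A'}; dividing by a nonzero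
    -- component of π shows that Z ∩ W is the line of λπ.
    have hm : m = (n i / R.p x i) • R.l x := by
      funext A
      have h1 := R.isSpinFrame.comp_vec hx m (R.p x) A i
      rw [hn, R.isSpinFrame.comp_vec hx] at h1
      rw [Pi.smul_apply, smul_eq_mul, div_mul_eq_mul_div, eq_div_iff hi, ← h1]
      ring
    rw [hm, Frame.vec_smul_left, map_smul, smul_apply, g.symm, h, smul_zero]

theorem mem_distH_iff_exists (hx : x ∈ R.dom) (v : TangentSpace (𝓡 4) x) :
    v ∈ distH g Z W x ↔ ∃ m n, v = R.e.vec x m (R.p x) + R.e.vec x (R.l x) n := by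
  rw [R.mem_distH_iff hx]
  constructor
  · exact R.isSpinFrame.exists_eq_vec_add_vec hx (R.isRep_l.ne_zero x hx) (R.isRep_p.ne_zero x hx)
  · rintro ⟨m, n, rfl⟩
    rw [map_add, add_apply, R.inner_Z hx (R.mem_Z hx _) (R.mem_Z hx _),
      R.inner_W hx (R.mem_W hx _) (R.mem_W hx _), add_zero]

theorem isSection_W {n : M → Fin 2 → ℝ} (hn : SmoothFn n R.dom) :
    IsSection W (fun y => R.e.vec y (R.l y) (n y)) R.dom :=
  ⟨Frame.smoothVF_vec R.isSpinFrame R.isRep_l.smooth hn, fun _ hx => R.mem_W hx _⟩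

theorem isSection_Z {m : M → Fin 2 → ℝ} (hm : SmoothFn m R.dom) :
    IsSection Z (fun y => R.e.vec y (m y) (R.p y)) R.dom :=
  ⟨Frame.smoothVF_vec R.isSpinFrame hm R.isRep_p.smooth, fun _ hx => R.mem_Z hx _⟩

theorem mem_distH_of_mem_Z (hx : x ∈ R.dom) {v : TangentSpace (𝓡 4) x} (hv : v ∈ Z x) :
    v ∈ distH g Z W x := (R.mem_distH_iff hx v).2 (R.inner_Z hx hv (R.mem_Z hx _))

theorem mem_distH_of_mem_W (hx : x ∈ R.dom) {v : TangentSpace (𝓡 4) x} (hv : v ∈ W x) :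
    v ∈ distH g Z W x := (R.mem_distH_iff hx v).2 (R.inner_W hx hv (R.mem_W hx _))

/-! ### Integrability of the `β`-distribution -/

/-- Pair [λν, λρ] with λρ, to which W is orthogonal. The term of ∇(λρ) vanishes since ρ_{A'}ρ^{A'} =
0, and that of ∇(λν) leaves S̃(λρ) ν_{A'}ρ^{A'} = 0. -/
theorem tildeSForm_W_eq_zero {V : Set M} (hV : IsOpen V) (hVd : V ⊆ R.dom)
    (h : IsIntegrableOn W V) (hx : x ∈ V) {v : TangentSpace (𝓡 4) x} (hv : v ∈ W x) :
    R.e.tildeSForm g x R.l v = 0 := by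
  have hF := R.isSpinFrame
  have hxd := hVd hx
  obtain ⟨r, rfl⟩ := (R.isRep_l.mem_iff x hxd _).1 hv
  by_cases hr : r = 0
  · rw [hr, ← zero_smul ℝ (0 : Fin 2 → ℝ), Frame.vec_smul_right, zero_smul, map_zero]
  -- The rotated spinor makes the contraction with r equal to r₀² + r₁².
  set n : Fin 2 → ℝ := ![r 1, - r 0] with hn
  have hnr : contract n r ≠ 0 := by
    rw [contract_eq]
    have := (sq_add_sq_pos hr).ne'
    contrapose! this
    simp [hn] at this
    linarith
  have hN := R.isSection_W (smoothFn_const n R.dom)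
  have hR := R.isSection_W (smoothFn_const r R.dom)
  have hN' := hN.smooth.diffVF R.isOpen_dom hxd
  have hR' := hR.smooth.diffVF R.isOpen_dom hxd
  have h1 := R.inner_W hxd (h V hV subset_rfl _ _ (hN.mono hVd) (hR.mono hVd) x hx)
    (R.mem_W hxd r)
  rw [mlieBracket_eq g hN' hR', map_sub, sub_apply,
    hF.inner_leviCivita_eq_tildeSForm R.isOpen_dom hxd hN' R.isRep_l.smooth (smoothFn_const r _),
    hF.inner_leviCivita_eq_tildeSForm R.isOpen_dom hxd hR' R.isRep_l.smooth (smoothFn_const n _),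
    contract_eq r r] at h1
  have h2 : R.e.tildeSForm g x R.l (R.e.vec x (R.l x) r) * contract n r = 0 := by linarith
  exact (mul_eq_zero.1 h2).resolve_right hnr

/-- W is in fact auto-parallel: as W is its own orthogonal complement, the derivative moves from Y
to test sections λν with ν constant, where S̃ controls it. -/
theorem isIntegrableOn_W {V : Set M} (hVd : V ⊆ R.dom)
    (h : ∀ x ∈ V, ∀ v ∈ W x, R.e.tildeSForm g x R.l v = 0) : IsIntegrableOn W V := by
  have key : IsAutoParallelOn g W V := by
    intro V' hV' hV'V X Y hX hY x hx
    have hxd := hVd (hV'V hx)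
    refine R.mem_W_of_inner hxd fun i => ?_
    have hX' := hX.smooth.diffVF hV' hx
    have hT := R.isSection_W (smoothFn_const (Pi.single i 1) R.dom)
    rw [inner_leviCivita_swap hV' hx hX' (hY.smooth.diffVF hV' hx)
      (hT.smooth.diffVF R.isOpen_dom hxd) fun y hy => R.inner_W (hVd (hV'V hy)) (hY.mem y hy)
        (R.mem_W (hVd (hV'V hy)) _)]
    obtain ⟨r, hr⟩ := (R.isRep_l.mem_iff x hxd _).1 (hY.mem x hx)
    rw [hr, R.isSpinFrame.inner_leviCivita_eq_tildeSForm R.isOpen_dom hxd hX' R.isRep_l.smooth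
      (smoothFn_const _ _), h x (hV'V hx) _ (hX.mem x hx)]
    simp
  exact key.isIntegrableOn

/-! ### Integrability of `𝓗` -/

theorem inner_leviCivita_Z (hZ : IsParallelOn g Z Set.univ) {V : Set M} (hV : IsOpen V)
    (hVd : V ⊆ R.dom) (hx : x ∈ V) {X Y : VF M} (hX : SmoothVF X V) (hY : IsSection Z Y V)
    {v : TangentSpace (𝓡 4) x} (hv : v ∈ Z x) : g.inner x (leviCivita g X Y x) v = 0 :=
  R.inner_Z (hVd hx) (hZ V hV (Set.subset_univ _) X Y hX hY x hx) hv

/-- For X = μπ and Y = λν, both in 𝓗, pair [X, Y] with λπ. The term ∇_Y X stays in Z and contributes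
nothing; ∇_X Y contributes -S̃(μπ) ν_{A'}π^{A'}, where ν is chosen with nonzero contraction. -/
theorem tildeSForm_Z_eq_zero (hZ : IsParallelOn g Z Set.univ) {V : Set M} (hV : IsOpen V)
    (hVd : V ⊆ R.dom) (h : IsIntegrableOn (distH g Z W) V) (hx : x ∈ V)
    {v : TangentSpace (𝓡 4) x} (hv : v ∈ Z x) : R.e.tildeSForm g x R.l v = 0 := by
  have hF := R.isSpinFrame
  have hxd := hVd hx
  obtain ⟨m, rfl⟩ := (R.isRep_p.mem_iff x hxd _).1 hv
  set n : Fin 2 → ℝ := ![R.p x 1, - R.p x 0] with hn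
  have hnp : contract n (R.p x) ≠ 0 := by
    rw [contract_eq]
    have := (sq_add_sq_pos (R.isRep_p.ne_zero x hxd)).ne'
    contrapose! this
    simp [hn] at this
    linarith
  have hX := (R.isSection_Z (smoothFn_const m R.dom)).mono hVd
  have hY := (R.isSection_W (smoothFn_const n R.dom)).mono hVd
  have hX' := hX.smooth.diffVF hV hx
  have hY' := hY.smooth.diffVF hV hx
  have h1 := (R.mem_distH_iff hxd _).1 (h V hV subset_rfl _ _
    ⟨hX.smooth, fun y hy => R.mem_distH_of_mem_Z (hVd hy) (hX.mem y hy)⟩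
    ⟨hY.smooth, fun y hy => R.mem_distH_of_mem_W (hVd hy) (hY.mem y hy)⟩ x hx)
  rw [mlieBracket_eq g hX' hY', map_sub, sub_apply,
    hF.inner_leviCivita_eq_tildeSForm R.isOpen_dom hxd hX' R.isRep_l.smooth (smoothFn_const n _),
    R.inner_leviCivita_Z hZ hV hVd hx hY.smooth hX (R.mem_Z hxd _), sub_zero, neg_eq_zero] at h1
  exact (mul_eq_zero.1 h1).resolve_right hnp

/-- The field λπ is a section of Z and of W at once. The derivative is moved onto it; its pairing
with the Z-part of Y vanishes by parallelism, and with the W-part because S̃(X) = 0. -/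
theorem isAutoParallelOn_distH (hZ : IsParallelOn g Z Set.univ) {V : Set M} (hVd : V ⊆ R.dom)
    (h : ∀ x ∈ V, ∀ v ∈ distH g Z W x, R.e.tildeSForm g x R.l v = 0) :
    IsAutoParallelOn g (distH g Z W) V := by
  intro V' hV' hV'V X Y hX hY x hx
  have hV'd := hV'V.trans hVd
  have hxd := hV'd hx
  have hX' := hX.smooth.diffVF hV' hx
  have hT := (R.isSection_W R.isRep_p.smooth).mono hV'd
  have hT' : IsSection Z (fun y => R.e.vec y (R.l y) (R.p y)) V' :=
    (R.isSection_Z R.isRep_l.smooth).mono hV'd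
  rw [R.mem_distH_iff hxd, inner_leviCivita_swap hV' hx hX' (hY.smooth.diffVF hV' hx)
    (hT.smooth.diffVF hV' hx) fun y hy => (R.mem_distH_iff (hV'd hy) _).1 (hY.mem y hy)]
  obtain ⟨m, n, hmn⟩ := (R.mem_distH_iff_exists hxd _).1 (hY.mem x hx)
  rw [hmn, map_add, R.inner_leviCivita_Z hZ hV' hV'd hx hX.smooth hT' (R.mem_Z hxd _),
    R.isSpinFrame.inner_leviCivita_eq_tildeSForm R.isOpen_dom hxd hX' R.isRep_l.smooth
      R.isRep_p.smooth, h x (hV'V hx) _ (hX.mem x hx)]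
  simp

/-! ### The spinor `κ` -/

theorem tildeSForm_distH_eq_zero (hx : x ∈ R.dom)
    (hZ : ∀ v ∈ Z x, R.e.tildeSForm g x R.l v = 0) (hW : ∀ v ∈ W x, R.e.tildeSForm g x R.l v = 0) :
    ∀ v ∈ distH g Z W x, R.e.tildeSForm g x R.l v = 0 := by
  intro v hv
  obtain ⟨m, n, rfl⟩ := (R.mem_distH_iff_exists hx _).1 hv
  rw [map_add, hZ _ (R.mem_Z hx _), hW _ (R.mem_W hx _), add_zero]

theorem tildeSForm_W_iff (hx : x ∈ R.dom) :
    (∀ v ∈ W x, R.e.tildeSForm g x R.l v = 0) ↔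
      ∀ B', ∑ B, R.l x B * R.e.tildeS g R.l x B B' = 0 := by
  constructor
  · intro h B'
    have := h _ (R.mem_W hx (Pi.single B' 1))
    rw [R.isSpinFrame.tildeSForm_vec hx] at this
    fin_cases B' <;> simp [Fin.sum_univ_two] at this ⊢ <;> linarith
  · intro h v hv
    obtain ⟨n, rfl⟩ := (R.isRep_l.mem_iff x hx _).1 hv
    rw [R.isSpinFrame.tildeSForm_vec hx]
    have h0 := h 0
    have h1 := h 1
    simp only [Fin.sum_univ_two] at h0 h1 ⊢
    linear_combination n 0 * h0 + n 1 * h1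

theorem tildeSForm_Z_iff (hx : x ∈ R.dom) :
    (∀ v ∈ Z x, R.e.tildeSForm g x R.l v = 0) ↔
      ∀ B, ∑ B', R.p x B' * R.e.tildeS g R.l x B B' = 0 := by
  constructor
  · intro h B
    have := h _ (R.mem_Z hx (Pi.single B 1))
    rw [R.isSpinFrame.tildeSForm_vec hx] at this
    fin_cases B <;> simp [Fin.sum_univ_two] at this ⊢ <;> linarith
  · intro h v hv
    obtain ⟨n, rfl⟩ := (R.isRep_p.mem_iff x hx _).1 hv
    rw [R.isSpinFrame.tildeSForm_vec hx]
    have h0 := h 0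
    have h1 := h 1
    simp only [Fin.sum_univ_two] at h0 h1 ⊢
    linear_combination n 0 * h0 + n 1 * h1

/-- `κ_{B'}` computed from `S̃_b = λ_B κ_{B'}`, with raised index. -/
def kappa (x : M) : Fin 2 → ℝ :=
  let K : Fin 2 → ℝ := fun B' => (R.l x 0 * R.e.tildeS g R.l x 1 B'
    - R.l x 1 * R.e.tildeS g R.l x 0 B') / (R.l x 0 ^ 2 + R.l x 1 ^ 2)
  ![K 1, - K 0]

theorem smoothFn_kappa : SmoothFn R.kappa R.dom := by
  have hl := smoothFn_pi.1 R.isRep_l.smooth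
  have hS := fun B B' => R.isSpinFrame.smoothFn_tildeS R.isOpen_dom R.isRep_l.smooth B B'
  have hK : ∀ B', SmoothFn (fun x => (R.l x 0 * R.e.tildeS g R.l x 1 B'
      - R.l x 1 * R.e.tildeS g R.l x 0 B') / (R.l x 0 ^ 2 + R.l x 1 ^ 2)) R.dom := fun B' =>
    (((hl 0).mul (hS 1 B')).sub ((hl 1).mul (hS 0 B'))).div
      ((((hl 0).mul (hl 0)).add ((hl 1).mul (hl 1))).congr fun x _ => by ring)
      fun x hx => (sq_add_sq_pos (R.isRep_l.ne_zero x hx)).ne'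
  rw [smoothFn_pi]
  intro i
  fin_cases i
  · exact hK 1
  · exact (hK 0).neg

/-- In dimension two, a covector annihilated by λ^B is a multiple of λ_B; `kappa` is the
coefficient, found by Euclidean pairing with λ_B. -/
theorem tildeS_eq_kappa (hx : x ∈ R.dom)
    (h : ∀ B', ∑ B, R.l x B * R.e.tildeS g R.l x B B' = 0) (B B' : Fin 2) :
    R.e.tildeS g R.l x B B' = lower (R.l x) B * lower (R.kappa x) B' := by
  have hN := (sq_add_sq_pos (R.isRep_l.ne_zero x hx)).ne'
  have h' := h B'
  rw [Fin.sum_univ_two] at h'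
  have hk : lower (R.kappa x) B' = (R.l x 0 * R.e.tildeS g R.l x 1 B'
      - R.l x 1 * R.e.tildeS g R.l x 0 B') / (R.l x 0 ^ 2 + R.l x 1 ^ 2) := by
    fin_cases B' <;> simp [lower_zero, lower_one, kappa]
  rw [hk, mul_div_assoc', eq_div_iff hN]
  fin_cases B <;> simp only [Fin.zero_eta, Fin.mk_one, lower_zero, lower_one]
  · linear_combination R.l x 0 * h'
  · linear_combination R.l x 1 * h'

theorem isKappa_kappa (h : IsIntegrableOn W R.dom) : R.IsKappa R.kappa :=
  ⟨R.smoothFn_kappa, fun _ hx => R.tildeS_eq_kappa hx ((R.tildeSForm_W_iff hx).1 fun _ hv =>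
    R.tildeSForm_W_eq_zero R.isOpen_dom subset_rfl h hx hv)⟩

variable {R}

theorem IsKappa.tildeSForm_W_eq_zero {k : M → Fin 2 → ℝ} (hk : R.IsKappa k) (hx : x ∈ R.dom) :
    ∀ v ∈ W x, R.e.tildeSForm g x R.l v = 0 := by
  refine (R.tildeSForm_W_iff hx).2 fun B' => ?_
  simp only [hk.eq x hx, Fin.sum_univ_two, lower_zero, lower_one]
  ring

theorem IsKappa.tildeSForm_Z_iff {k : M → Fin 2 → ℝ} (hk : R.IsKappa k) (hx : x ∈ R.dom) :
    (∀ v ∈ Z x, R.e.tildeSForm g x R.l v = 0) ↔ ∑ B', R.p x B' * lower (k x) B' = 0 := by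
  rw [R.tildeSForm_Z_iff hx]
  have e : ∀ B, ∑ B', R.p x B' * R.e.tildeS g R.l x B B' =
      lower (R.l x) B * ∑ B', R.p x B' * lower (k x) B' := fun B => by
    simp only [hk.eq x hx, Fin.sum_univ_two]; ring
  simp only [e]
  refine ⟨fun h => ?_, fun h B => by rw [h, mul_zero]⟩
  have h0 := h 0
  have h1 := h 1
  rw [lower_zero] at h0
  rw [lower_one] at h1
  have := (sq_add_sq_pos (R.isRep_l.ne_zero x hx)).ne'
  have h2 : (R.l x 0 ^ 2 + R.l x 1 ^ 2) * ∑ B', R.p x B' * lower (k x) B' = 0 := by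
    linear_combination R.l x 0 * h1 - R.l x 1 * h0
  exact (mul_eq_zero.1 h2).resolve_left this

variable (R)

/-- The integrability of `𝓗` in terms of `κ`, on any open subset of the domain. -/
theorem isIntegrableOn_distH_iff (hZ : IsParallelOn g Z Set.univ) {V : Set M} (hV : IsOpen V)
    (hVd : V ⊆ R.dom) {k : M → Fin 2 → ℝ} (hk : R.IsKappa k) :
    IsIntegrableOn (distH g Z W) V ↔ ∀ x ∈ V, ∑ B', R.p x B' * lower (k x) B' = 0 := by
  constructor
  · intro h x hx
    exact (hk.tildeSForm_Z_iff (hVd hx)).1 fun _ => R.tildeSForm_Z_eq_zero hZ hV hVd h hx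
  · intro h
    exact (R.isAutoParallelOn_distH hZ hVd fun x hx => R.tildeSForm_distH_eq_zero (hVd hx)
      ((hk.tildeSForm_Z_iff (hVd hx)).2 (h x hx))
      (hk.tildeSForm_W_eq_zero (hVd hx))).isIntegrableOn

theorem smul_p_of_contract (hx : x ∈ R.dom) {k : Fin 2 → ℝ}
    (h : ∑ B', R.p x B' * lower k B' = 0) :
    k = ((k 0 * R.p x 0 + k 1 * R.p x 1) / (R.p x 0 ^ 2 + R.p x 1 ^ 2)) • R.p x := by
  have hN := (sq_add_sq_pos (R.isRep_p.ne_zero x hx)).ne'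
  rw [Fin.sum_univ_two, lower_zero, lower_one] at h
  funext i
  rw [Pi.smul_apply, smul_eq_mul, div_mul_eq_mul_div, eq_div_iff hN]
  fin_cases i <;> simp only [Fin.zero_eta, Fin.mk_one]
  · linear_combination R.p x 1 * h
  · linear_combination -R.p x 0 * h

/-- The Euclidean projection coefficient is a quotient of smooth functions with denominator |π|² >
0, so the factor is smooth also across zeros of κ. -/
theorem exists_smul_p {k : M → Fin 2 → ℝ} (hk : SmoothFn k R.dom)
    (h : ∀ x ∈ R.dom, ∑ B', R.p x B' * lower (k x) B' = 0) :
    ∃ f : M → ℝ, SmoothFn f R.dom ∧ ∀ x ∈ R.dom, k x = f x • R.p x := by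
  have hp := smoothFn_pi.1 R.isRep_p.smooth
  have hk := smoothFn_pi.1 hk
  refine ⟨_, ?_, fun x hx => R.smul_p_of_contract hx (h x hx)⟩
  exact (((hk 0).mul (hp 0)).add ((hk 1).mul (hp 1))).div
    ((((hp 0).mul (hp 0)).add ((hp 1).mul (hp 1))).congr fun x _ => by ring)
    fun x hx => (sq_add_sq_pos (R.isRep_p.ne_zero x hx)).ne'

theorem isRepAlpha_smul {k : M → Fin 2 → ℝ} (hk : SmoothFn k R.dom)
    (h0 : ∀ x ∈ R.dom, k x ≠ 0) {f : M → ℝ} (hf : ∀ x ∈ R.dom, k x = f x • R.p x) :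
    IsRepAlpha R.e R.dom Z k := by
  refine ⟨hk, h0, fun x hx v => ?_⟩
  have hfx : f x ≠ 0 := fun h => h0 x hx (by rw [hf x hx, h, zero_smul])
  rw [R.isRep_p.mem_iff x hx, hf x hx]
  constructor
  · rintro ⟨m, rfl⟩
    refine ⟨(f x)⁻¹ • m, ?_⟩
    rw [Frame.vec_smul_left, Frame.vec_smul_right, smul_smul, inv_mul_cancel₀ hfx, one_smul]
  · rintro ⟨m, rfl⟩
    exact ⟨f x • m, by rw [Frame.vec_smul_left, Frame.vec_smul_right]⟩

theorem isRepBeta_smul {f : M → ℝ} (hf : SmoothFn f R.dom) (h0 : ∀ x ∈ R.dom, f x ≠ 0) :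
    IsRepBeta R.e R.dom W (fun x => f x • R.l x) := by
  refine ⟨ContMDiffOn.smul hf R.isRep_l.smooth,
    fun x hx => smul_ne_zero (h0 x hx) (R.isRep_l.ne_zero x hx), fun x hx v => ?_⟩
  have hfx := h0 x hx
  rw [R.isRep_l.mem_iff x hx]
  constructor
  · rintro ⟨n, rfl⟩
    refine ⟨(f x)⁻¹ • n, ?_⟩
    rw [Frame.vec_smul_left, Frame.vec_smul_right, smul_smul, mul_inv_cancel₀ hfx, one_smul]
  · rintro ⟨n, rfl⟩
    exact ⟨f x • n, by rw [Frame.vec_smul_left, Frame.vec_smul_right]⟩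

theorem contract_eq_zero_of_isRepAlpha {k : M → Fin 2 → ℝ} (h : IsRepAlpha R.e R.dom Z k)
    (hx : x ∈ R.dom) : ∑ B', R.p x B' * lower (k x) B' = 0 := by
  obtain ⟨m, hm⟩ := (R.isRep_p.mem_iff x hx _).1
    ((h.mem_iff x hx (R.e.vec x (Pi.single 0 1) (k x))).2 ⟨_, rfl⟩)
  have h1 := fun B' => R.isSpinFrame.comp_vec hx m (R.p x) 0 B'
  simp only [← hm, R.isSpinFrame.comp_vec hx, Pi.single_eq_same, one_mul] at h1
  rw [Fin.sum_univ_two, lower_zero, lower_one, h1 0, h1 1]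
  ring

end ScaledReps

end AlphaBeta

end

noncomputable section

namespace AlphaBeta

variable {M : Type*} [TopologicalSpace M] [ChartedSpace E4 M] [IsManifold (𝓡 4) ∞ M]
  {g : NeutralMetric M} {Z W : Distribution M}

/-! ### Unions of domains, rescaling, and the global statement on 𝓗 -/

theorem isIntegrableOn_biUnion {D : Distribution M} {Rs : Set (ScaledReps g Z W)} :
    IsIntegrableOn D (⋃ R ∈ Rs, R.dom) ↔ ∀ R ∈ Rs, IsIntegrableOn D R.dom := by
  refine ⟨fun h R hR => h.mono (Set.subset_biUnion_of_mem (u := fun R => R.dom) hR),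
    fun h => isIntegrableOn_of_locally fun x hx => ?_⟩
  obtain ⟨R, hR, hxR⟩ := Set.mem_iUnion₂.1 hx
  exact ⟨R.dom, R.isOpen_dom, hxR, (h R hR).mono Set.inter_subset_left⟩

namespace ScaledReps

variable (R : ScaledReps g Z W)

/-- `W` and `𝓗` are both integrable iff `λ_A ∇_b λ^A` is proportional to `λ_B π_{B'}`. -/
theorem isIntegrableOn_W_and_distH_iff (hZ : IsParallelOn g Z Set.univ) :
    IsIntegrableOn W R.dom ∧ IsIntegrableOn (distH g Z W) R.dom ↔
      ∃ f : M → ℝ, ∀ x ∈ R.dom, ∀ B B', R.e.tildeS g R.l x B B' =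
        f x * (lower (R.l x) B * lower (R.p x) B') := by
  constructor
  · rintro ⟨hW, hH⟩
    have hk := R.isKappa_kappa hW
    obtain ⟨f, -, hf⟩ := R.exists_smul_p hk.smooth
      ((R.isIntegrableOn_distH_iff hZ R.isOpen_dom subset_rfl hk).1 hH)
    refine ⟨f, fun x hx B B' => ?_⟩
    rw [hk.eq x hx, hf x hx, lower_smul]
    ring
  -- Only the values of `f` matter: S̃ kills W since λ^Bλ_B = 0 and Z since π^{B'}π_{B'} = 0,
  -- pointwise.
  · rintro ⟨f, hf⟩
    have h1 : ∀ x ∈ R.dom, ∀ v ∈ W x, R.e.tildeSForm g x R.l v = 0 := fun x hx =>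
      (R.tildeSForm_W_iff hx).2 fun B' => by
        simp only [hf x hx, Fin.sum_univ_two, lower_zero, lower_one]
        ring
    have h2 : ∀ x ∈ R.dom, ∀ v ∈ Z x, R.e.tildeSForm g x R.l v = 0 := fun x hx =>
      (R.tildeSForm_Z_iff hx).2 fun B => by
        simp only [hf x hx, Fin.sum_univ_two, lower_zero, lower_one]
        ring
    exact ⟨R.isIntegrableOn_W subset_rfl h1, (R.isAutoParallelOn_distH hZ subset_rfl fun x hx =>
      R.tildeSForm_distH_eq_zero hx (h2 x hx) (h1 x hx)).isIntegrableOn⟩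

/-- Where `λ_A ∇_b λ^A` has no zeros, either of the scaled representatives can be rescaled so that
`λ_A ∇_b λ^A = λ_B π_{B'}`. -/
theorem exists_rescaling (hZ : IsParallelOn g Z Set.univ) (hW : IsIntegrableOn W R.dom)
    (hH : IsIntegrableOn (distH g Z W) R.dom) (h0 : ∀ x ∈ R.dom, R.e.tildeS g R.l x ≠ 0) :
    (∃ p : M → Fin 2 → ℝ, IsRepAlpha R.e R.dom Z p ∧ ∀ x ∈ R.dom, ∀ B B',
      R.e.tildeS g R.l x B B' = lower (R.l x) B * lower (p x) B') ∧
    (∃ l : M → Fin 2 → ℝ, IsRepBeta R.e R.dom W l ∧ ∀ x ∈ R.dom, ∀ B B',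
      R.e.tildeS g l x B B' = lower (l x) B * lower (R.p x) B') := by
  have hk := R.isKappa_kappa hW
  obtain ⟨f, hfs, hf⟩ := R.exists_smul_p hk.smooth
    ((R.isIntegrableOn_distH_iff hZ R.isOpen_dom subset_rfl hk).1 hH)
  have hk0 : ∀ x ∈ R.dom, R.kappa x ≠ 0 := fun x hx h => h0 x hx <| by
    funext B B'
    rw [hk.eq x hx, h]
    simp [lower]
  have hf0 : ∀ x ∈ R.dom, f x ≠ 0 := fun x hx h => hk0 x hx (by rw [hf x hx, h, zero_smul])
  -- With κ = fπ, scaling λ by c turns S̃_b into c²f λ_B π_{B'}, which has to equal cλ_B π_{B'};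
  -- hence c = 1/f.
  have hi : SmoothFn (fun x => 1 / f x) R.dom := (smoothFn_const 1 _).div hfs hf0
  refine ⟨⟨R.kappa, R.isRepAlpha_smul hk.smooth hk0 hf, hk.eq⟩,
    ⟨_, R.isRepBeta_smul hi fun x hx => one_div_ne_zero (hf0 x hx), fun x hx B B' => ?_⟩⟩
  have hfx := hf0 x hx
  rw [Frame.tildeS_smul R.e R.isOpen_dom hx hi R.isRep_l.smooth, hk.eq x hx, hf x hx, lower_smul,
    lower_smul]
  field_simp

end ScaledReps

/-- Auto-parallelism is local, so it is enough to work on U ∩ dom around each point, where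
integrability of W and 𝓗 makes S̃ vanish on W and Z, hence on 𝓗. -/
theorem IsSesquiWalker.isIntegrableOn_distH_iff_isAutoParallelOn (h : IsSesquiWalker g Z W)
    {U : Set M} (hU : IsOpen U) :
    IsIntegrableOn (distH g Z W) U ↔ IsAutoParallelOn g (distH g Z W) U := by
  refine ⟨fun hH => isAutoParallelOn_of_locally fun x _ => ?_, fun hH => hH.isIntegrableOn⟩
  obtain ⟨R, hxR⟩ := h.pair x
  have hRU := R.isOpen_dom.inter hU
  refine ⟨R.dom, R.isOpen_dom, hxR, R.isAutoParallelOn_distH h.parallel Set.inter_subset_left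
    fun y hy => R.tildeSForm_distH_eq_zero hy.1 (fun v hv => ?_) fun v hv => ?_⟩
  · exact R.tildeSForm_Z_eq_zero h.parallel hRU Set.inter_subset_left
      (hH.mono Set.inter_subset_right) hy hv
  · exact R.tildeSForm_W_eq_zero hRU Set.inter_subset_left
      (h.integrable.mono (Set.subset_univ _)) hy hv

end AlphaBeta

end

theorem lemma2p3 {M : Type*} [TopologicalSpace M] [ChartedSpace AlphaBeta.E4 M]
    [IsManifold (𝓡 4) ∞ M] (g : AlphaBeta.NeutralMetric M) (Z W : AlphaBeta.Distribution M) :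
    -- Walker geometry with a β-distribution, on any union of domains of scaled representatives
    (AlphaBeta.IsWalkerWithBeta g Z W → ∀ Rs : Set (AlphaBeta.ScaledReps g Z W),
      (AlphaBeta.IsIntegrableOn W (⋃ R ∈ Rs, R.dom) ∧
        AlphaBeta.IsIntegrableOn (AlphaBeta.distH g Z W) (⋃ R ∈ Rs, R.dom)) ↔
      ∀ R ∈ Rs, ∃ f : M → ℝ, ∀ x ∈ R.dom, ∀ B B',
        R.e.tildeS g R.l x B B' =
          f x * (AlphaBeta.lower (R.l x) B * AlphaBeta.lower (R.p x) B')) ∧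
    (AlphaBeta.IsSesquiWalker g Z W →
      -- the spinor κ exists for all scaled representatives
      (∀ R : AlphaBeta.ScaledReps g Z W, ∃ k, R.IsKappa k) ∧
      -- 𝓗 is integrable iff π^{B'} κ_{B'} = 0
      (∀ (Rs : Set (AlphaBeta.ScaledReps g Z W))
        (k : AlphaBeta.ScaledReps g Z W → M → Fin 2 → ℝ), (∀ R ∈ Rs, R.IsKappa (k R)) →
        (AlphaBeta.IsIntegrableOn (AlphaBeta.distH g Z W) (⋃ R ∈ Rs, R.dom) ↔
          ∀ R ∈ Rs, ∀ x ∈ R.dom, ∑ B', R.p x B' * AlphaBeta.lower (k R x) B' = 0)) ∧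
      -- i.e. κ is a smooth multiple of π, and a scaled representative where it has no zero
      (∀ (R : AlphaBeta.ScaledReps g Z W) (k : M → Fin 2 → ℝ), R.IsKappa k →
        (AlphaBeta.IsIntegrableOn (AlphaBeta.distH g Z W) R.dom ↔
          ∃ f : M → ℝ, AlphaBeta.SmoothFn f R.dom ∧ ∀ x ∈ R.dom, k x = f x • R.p x) ∧
        ((∀ x ∈ R.dom, k x ≠ 0) →
          (AlphaBeta.IsIntegrableOn (AlphaBeta.distH g Z W) R.dom ↔
            AlphaBeta.IsRepAlpha R.e R.dom Z k))) ∧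
      -- either representative can be rescaled, the other being given
      (∀ R : AlphaBeta.ScaledReps g Z W,
        AlphaBeta.IsIntegrableOn (AlphaBeta.distH g Z W) R.dom →
        (∀ x ∈ R.dom, R.e.tildeS g R.l x ≠ 0) →
        (∃ p : M → Fin 2 → ℝ, AlphaBeta.IsRepAlpha R.e R.dom Z p ∧
          ∀ x ∈ R.dom, ∀ B B', R.e.tildeS g R.l x B B' =
            AlphaBeta.lower (R.l x) B * AlphaBeta.lower (p x) B') ∧
        (∃ l : M → Fin 2 → ℝ, AlphaBeta.IsRepBeta R.e R.dom W l ∧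
          ∀ x ∈ R.dom, ∀ B B', R.e.tildeS g l x B B' =
            AlphaBeta.lower (l x) B * AlphaBeta.lower (R.p x) B')) ∧
      -- 𝓗 is integrable iff it is auto-parallel
      (∀ U : Set M, IsOpen U →
        (AlphaBeta.IsIntegrableOn (AlphaBeta.distH g Z W) U ↔
          AlphaBeta.IsAutoParallelOn g (AlphaBeta.distH g Z W) U))) := by
  refine ⟨fun h Rs => ?_, fun h => ?_⟩
  · rw [AlphaBeta.isIntegrableOn_biUnion, AlphaBeta.isIntegrableOn_biUnion, ← forall₂_and]
    exact forall₂_congr fun R _ => R.isIntegrableOn_W_and_distH_iff h.parallel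
  have hW : ∀ R : AlphaBeta.ScaledReps g Z W, AlphaBeta.IsIntegrableOn W R.dom := fun R =>
    h.integrable.mono (Set.subset_univ _)
  refine ⟨fun R => ⟨_, R.isKappa_kappa (hW R)⟩, fun Rs k hk => ?_, fun R k hk => ?_,
    fun R hH h0 => R.exists_rescaling h.parallel (hW R) hH h0,
    fun U hU => h.isIntegrableOn_distH_iff_isAutoParallelOn hU⟩
  · rw [AlphaBeta.isIntegrableOn_biUnion]
    exact forall₂_congr fun R hR =>
      R.isIntegrableOn_distH_iff h.parallel R.isOpen_dom subset_rfl (hk R hR)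
  · rw [R.isIntegrableOn_distH_iff h.parallel R.isOpen_dom subset_rfl hk]
    refine ⟨⟨R.exists_smul_p hk.smooth, ?_⟩, fun hk0 => ⟨fun hH => ?_, fun hr x hx =>
      R.contract_eq_zero_of_isRepAlpha hr hx⟩⟩
    · rintro ⟨f, -, hf⟩ x hx
      rw [hf x hx, Fin.sum_univ_two, AlphaBeta.lower_zero, AlphaBeta.lower_one, Pi.smul_apply,
        Pi.smul_apply, smul_eq_mul, smul_eq_mul]
      ring
    · obtain ⟨f, -, hf⟩ := R.exists_smul_p hk.smooth hH
      exact R.isRepAlpha_smul hk.smooth hk0 hf
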